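/- **Setting.** Consider $m$ followers $J\ddot{\bar x}+B\dot{\bar x}=\bar w$ with $J=\mathrm{diag}\{J_i\}$, $J_i>0$, and $B=\mathrm{diag}\{b_i\}$, $b_i\in\mathbb R$; the phase-lead controller $\mathbf C_w=\Phi(sI+\mathrm{diag}\{p_i\})(sI+\mathrm{diag}\{q_i\})^{-1}$ with $\Phi=\mathrm{diag}\{\phi_i\}$, $\phi_i>0$, $0<p_i<q_i$; shaped outputs $\bar y=(sI+\Theta)\bar x$ with $\Theta=\mathrm{diag}\{\theta_i\}$, $\theta_i>0$; and, for a feedback gain $K^\ast=\mathrm{diag}\{k_i^\ast\}$, $$\mathbf W_w=\mathbf C_w(sI+\Theta)\,\Pi_w^{-1},\qquad \Pi_w=Js^2+Bs+K^\ast\mathbf C_w(sI+\Theta).$$ A real-rational square matrix $\mathbf W(s)$ is positive real if it is analytic in $\Re s>0$ and $\mathbf W(s)+\mathbf W(s)^*\succeq0$ there; it is SPR if $\mathbf W(s-\epsilon)$ is positive real for some $\epsilon>0$. The network has weights $w_{ij}\ge0$ (from follower $j$ to follower $i$) and $w_{i0}\ge0$ (from the leader) with $\sum_j w_{ij}+w_{i0}=1$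 for all $i$, and every follower is reachable from the leader along edges of positive weight. The leader has position $x_0$ and shaped output $y_0=\dot x_0+\theta_0x_0$, $\theta_0\in\mathbb R$. The shaped synchronization error $\bar e_y=[e_{y,1},\dots,e_{y,m}]^\top$ is given by $e_{y,i}=\sum_jw_{ij}y_j+w_{i0}y_0-y_i$. Let $\ddot\Omega_{x_0}=\mathbf C_w^{-1}(\mathbf 1_m\ddot x_0)$ and $\dot\Omega_{x_0}=\mathbf C_w^{-1}(\mathbf 1_m\dot x_0)$ (arbitrary initial filter states), let $\eta_w=[\bar e_y^\top,\ddot\Omega_{x_0}^\top,\dot\Omega_{x_0}^\top]^\top$, and let $\tilde\Xi_w=[\tilde\Xi_1,\tilde\Xi_2,\tilde\Xi_3]\in\mathbb R^{m\times3m}$ be the parameter error. The *error system* (without disturbance) is the error model $\bar e_y=\mathbf W_w\tilde\Xi_w\eta_w$, written in state-space form as $$\dot{\bar e}_x=\mathbf A_w\bar e_x+\mathbf B_w\tilde\Xi_w\eta_w,\qquad \bar e_y=\mathbf c_w^\top\bar e_x,$$ where $\mathbf W_w=\mathbf c_w^\top(sI-\mathbf A_w)^{-1}\mathbf B_w$ is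 any realization (not necessarily minimal) with $\mathbf A_w$ Hurwitz, together with the gradient law $$\dot{\tilde\Xi}_w=-[\Gamma_{\xi_1},\Gamma_{\xi_2},\Gamma_{\xi_3}](I_3\otimes\bar e_y)\,\mathrm{diag}\{\bar e_y^\top,\ddot\Omega_{x_0}^\top,\dot\Omega_{x_0}^\top\}$$ with diagonal gains $\Gamma_{\xi_l}\succ0$. **Claim.** 1. *Closed-loop transfer.* $\mathbf W_w$ is the transfer from $r$ to $\bar y$ of the loop $(Js^2+Bs)\bar x=\mathbf C_w(r-K^\ast\bar y)$, $\bar y=(sI+\Theta)\bar x$. 2. *Shaping gives SPR.* There is $\kappa\in\mathbb R$ such that $\mathbf W_w$ is SPR whenever $k_i^\ast\ge\kappa$ for all $i$. 3. *Lyapunov pair.* Let $K^\ast$ be any gain for which $\mathbf W_w$ is SPR. Then for every realization $(\mathbf A_w,\mathbf B_w,\mathbf c_w)$ as above there are symmetric $\mathbb P_w\succ0$, $\mathbb Q_w\succ0$ with $\mathbf A_w^\top\mathbb P_w+\mathbb P_w\mathbf A_w=-\mathbb Q_w$ and $\mathbb P_w\mathbf B_w=\mathbf c_w$. 4. *Stability.*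 Let $K^\ast$ and $(\mathbf A_w,\mathbf B_w,\mathbf c_w)$ be as in 3. Along every solution of the error system on $[0,\infty)$: - for every such pair $(\mathbb P_w,\mathbb Q_w)$, the function $V_w=\bar e_x^\top\mathbb P_w\bar e_x+\sum_{l=1}^3\mathrm{tr}[\tilde\Xi_l^\top\Gamma_{\xi_l}^{-1}\tilde\Xi_l]$ satisfies $\dot V_w=-\bar e_x^\top\mathbb Q_w\bar e_x\le0$; - $\bar e_x,\bar e_y,\tilde\Xi_w\in\mathcal L_\infty$ and $\bar e_x\in\mathcal L_2$; - if $\dot x_0$ and $\ddot x_0$ are bounded, then $\eta_w$ is bounded, $\bar e_x(t)\to0$, $\bar e_y(t)\to\mathbf 0_m$ and $y_i(t)-y_0(t)\to0$ for all $i$; if $x_0$ is bounded as well, then $\bar y$, $\bar x$ and $\dot{\bar x}$ are also bounded. -/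

import Mathlib

namespace ShapedSync

noncomputable section

open Matrix

/-! ### Transfer matrices -/

/-- A constant real diagonal matrix, as a matrix over the field `ℝ(s)` of real rational functions. -/
def diagGain {m : ℕ} (a : Fin m → ℝ) : Matrix (Fin m) (Fin m) (RatFunc ℝ) :=
  Matrix.diagonal fun i => RatFunc.C (a i)

/-- The matrix `s I`. -/
def sId (m : ℕ) : Matrix (Fin m) (Fin m) (RatFunc ℝ) :=
  Matrix.diagonal fun _ => RatFunc.X

/-- The phase-lead controller `C_w = Φ N D⁻¹`, `N = s I + diag p`, `D = s I + diag q`. -/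
def leadController {m : ℕ} (φ p q : Fin m → ℝ) : Matrix (Fin m) (Fin m) (RatFunc ℝ) :=
  diagGain φ * (sId m + diagGain p) * (sId m + diagGain q)⁻¹

/-- `Π_w = J s² + B s + K⋆ C_w (s I + Θ)`. -/
def closedLoopPencil {m : ℕ} (J b φ p q θ k : Fin m → ℝ) :
    Matrix (Fin m) (Fin m) (RatFunc ℝ) :=
  diagGain J * sId m ^ 2 + diagGain b * sId m
    + diagGain k * leadController φ p q * (sId m + diagGain θ)

/-- The output-shaped closed-loop transfer matrix `W_w = C_w (s I + Θ) Π_w⁻¹`. -/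
def shapedTransfer {m : ℕ} (J b φ p q θ k : Fin m → ℝ) :
    Matrix (Fin m) (Fin m) (RatFunc ℝ) :=
  leadController φ p q * (sId m + diagGain θ) * (closedLoopPencil J b φ p q θ k)⁻¹

/-- The value `W(z)` of a real-rational matrix at a complex number. Entries are evaluated in lowest
terms, so this is the value of the function wherever `z` is not a pole; a pole gets the value `0`,
and the function is then not even continuous there. -/
def evalAt {m : ℕ} (W : Matrix (Fin m) (Fin m) (RatFunc ℝ)) (z : ℂ) :
    Matrix (Fin m) (Fin m) ℂ :=
  Matrix.of fun i j => RatFunc.eval (algebraMap ℝ ℂ) z (W i j)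

section

open scoped ComplexOrder

/-- Positive realness: analytic in the open right half plane, with positive semidefinite Hermitian
part there. -/
def IsPositiveReal {m : ℕ} (F : ℂ → Matrix (Fin m) (Fin m) ℂ) : Prop :=
  (∀ i j, AnalyticOnNhd ℂ (fun z => F z i j) {z : ℂ | 0 < z.re}) ∧
    ∀ z : ℂ, 0 < z.re → (F z + (F z)ᴴ).PosSemidef

end

/-- Strict positive realness: `W(s - ε)` is positive real for some `ε > 0`. -/
def IsSPR {m : ℕ} (W : Matrix (Fin m) (Fin m) (RatFunc ℝ)) : Prop :=
  ∃ ε : ℝ, 0 < ε ∧ IsPositiveReal fun z => evalAt W (z - (ε : ℂ))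

/-! ### State space -/

/-- All eigenvalues of the real matrix `A` lie in the open left half plane. -/
def IsHurwitz {n : ℕ} (A : Matrix (Fin n) (Fin n) ℝ) : Prop :=
  ∀ μ ∈ spectrum ℂ (A.map (algebraMap ℝ ℂ)), μ.re < 0

/-- `(A, B, c)` is an internally stable (not necessarily minimal) state-space realization of `W`,
that is, `A` is Hurwitz and `W = cᵀ (s I - A)⁻¹ B`. -/
structure IsStableRealization {m n : ℕ} (W : Matrix (Fin m) (Fin m) (RatFunc ℝ))
    (A : Matrix (Fin n) (Fin n) ℝ) (B c : Matrix (Fin n) (Fin m) ℝ) : Prop where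
  hurwitz : IsHurwitz A
  transfer : W = cᵀ.map RatFunc.C * (sId n - A.map RatFunc.C)⁻¹ * B.map RatFunc.C

/-- Symmetric positive definite `P`, `Q` with `Aᵀ P + P A = -Q` and `P B = c`. -/
structure IsLyapunovPair {m n : ℕ} (A : Matrix (Fin n) (Fin n) ℝ)
    (B c : Matrix (Fin n) (Fin m) ℝ) (P Q : Matrix (Fin n) (Fin n) ℝ) : Prop where
  posDef_P : P.PosDef
  posDef_Q : Q.PosDef
  lyapunov : Aᵀ * P + P * A = -Q
  output : P * B = c

/-! ### The network -/

/-- A weighted directed network of `m` followers and one leader. `w i j` is the weight of the edge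
along which follower `j` sends to follower `i`, and `w0 i` the weight of the edge from the leader
to follower `i`; a zero weight means that the edge is absent. -/
structure Network (m : ℕ) where
  w : Fin m → Fin m → ℝ
  w0 : Fin m → ℝ
  w_nonneg : ∀ i j, 0 ≤ w i j
  w0_nonneg : ∀ i, 0 ≤ w0 i
  /-- the incoming weights of each follower sum to one -/
  balance : ∀ i, (∑ j, w i j) + w0 i = 1
  /-- there is a directed path from the leader to each follower -/
  reachable : ∀ i, ∃ j, 0 < w0 j ∧ Relation.ReflTransGen (fun a b => 0 < w b a) j i

/-! ### Signals -/

/-- `f` is differentiable on `[0, ∞)` (one-sidedly at `0`) with derivative `f'`. -/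
def HasDerivOnTime {E : Type*} [NormedAddCommGroup E] [NormedSpace ℝ E] (f f' : ℝ → E) : Prop :=
  ∀ t, 0 ≤ t → HasDerivWithinAt f (f' t) (Set.Ici 0) t

/-- A vector signal is bounded on `[0, ∞)` (in `L_∞`), in the pointwise sense. -/
def BoundedSignal {ι : Type*} (f : ℝ → ι → ℝ) : Prop :=
  ∃ M : ℝ, ∀ t, 0 ≤ t → ∀ i, |f t i| ≤ M

/-- Membership of a vector signal in `L_2` on `[0, ∞)`. -/
def SquareIntegrableSignal {ι : Type*} [Fintype ι] (f : ℝ → ι → ℝ) : Prop :=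
  MeasureTheory.IntegrableOn (fun t => ∑ i, f t i ^ 2) (Set.Ici 0)

/-- `v = C_w⁻¹ u`, for the entrywise filter `C_w⁻¹ = Φ⁻¹ (s I + diag q) (s I + diag p)⁻¹
= Φ⁻¹ (I + diag (q - p) (s I + diag p)⁻¹)` with arbitrary initial state, applied to the scalar
signal `u` replicated `m` times. -/
def IsInverseLeadFiltered {m : ℕ} (φ p q : Fin m → ℝ) (u : ℝ → ℝ) (v : ℝ → Fin m → ℝ) : Prop :=
  ∃ ζ : ℝ → Fin m → ℝ,
    HasDerivOnTime ζ (fun t i => -p i * ζ t i + u t) ∧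
      ∀ t, 0 ≤ t → ∀ i, v t i = (φ i)⁻¹ * (u t + (q i - p i) * ζ t i)

/-- The time signals of the adaptive loop, with an internal error state of dimension `n`. -/
structure Signals (m n : ℕ) where
  /-- leader position, velocity and acceleration -/
  x0 : ℝ → ℝ
  dx0 : ℝ → ℝ
  ddx0 : ℝ → ℝ
  /-- follower positions and velocities -/
  x : ℝ → Fin m → ℝ
  dx : ℝ → Fin m → ℝ
  /-- leader acceleration and velocity filtered through `C_w⁻¹` -/
  ddΩ : ℝ → Fin m → ℝ
  dΩ : ℝ → Fin m → ℝ
  /-- internal state of the error model -/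
  ex : ℝ → Fin n → ℝ
  /-- parameter error, in its three square blocks (for the parameters `K`, `J`, `B`) -/
  Ξ : ℝ → Fin 3 → Matrix (Fin m) (Fin m) ℝ

namespace Signals

variable {m n : ℕ}

/-- Shaped follower outputs `y = (s I + Θ) x`. -/
def y (S : Signals m n) (θ : Fin m → ℝ) (t : ℝ) : Fin m → ℝ :=
  fun i => S.dx t i + θ i * S.x t i

/-- Shaped leader output `y₀ = (s + θ₀) x₀`. -/
def y0 (S : Signals m n) (θ0 : ℝ) (t : ℝ) : ℝ :=
  S.dx0 t + θ0 * S.x0 t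

/-- Shaped synchronization error `e_y = z_y - y`, where `z_y` is the weighted sum of the shaped
outputs that a follower receives from its neighbours and from the leader. -/
def ey (S : Signals m n) (N : Network m) (θ : Fin m → ℝ) (θ0 : ℝ) (t : ℝ) : Fin m → ℝ :=
  fun i => (∑ j, N.w i j * S.y θ t j) + N.w0 i * S.y0 θ0 t - S.y θ t i

/-- The three blocks of the regressor `η_w`. -/
def η (S : Signals m n) (N : Network m) (θ : Fin m → ℝ) (θ0 : ℝ) (t : ℝ) :
    Fin 3 → Fin m → ℝ :=
  ![S.ey N θ θ0 t, S.ddΩ t, S.dΩ t]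

/-- The product `Ξ̃_w η_w`. -/
def mismatch (S : Signals m n) (N : Network m) (θ : Fin m → ℝ) (θ0 : ℝ) (t : ℝ) : Fin m → ℝ :=
  ∑ l, S.Ξ t l *ᵥ S.η N θ θ0 t l

/-- The Lyapunov function `e_xᵀ P e_x + tr [Ξ̃ᵀ Γ⁻¹ Ξ̃]`, in which every block of `Ξ̃` is weighted by
its own gain. -/
def lyapunov (S : Signals m n) (P : Matrix (Fin n) (Fin n) ℝ) (Γ : Fin 3 → Fin m → ℝ) (t : ℝ) : ℝ :=
  S.ex t ⬝ᵥ P *ᵥ S.ex t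
    + ∑ l, ((S.Ξ t l)ᵀ * (Matrix.diagonal (Γ l))⁻¹ * S.Ξ t l).trace

/-- The equations of the disturbance-free output-shaped adaptive loop: the leader and follower
kinematics, the filtered leader signals, the error model `e_y = W_w Ξ̃_w η_w` in its state-space form
`(A, B, c)`, and the gradient law
`dΞ̃/dt = -[Γ₁, Γ₂, Γ₃] (I₃ ⊗ e_y) diag (e_yᵀ, ddΩᵀ, dΩᵀ) = -[Γ₁ e_y e_yᵀ, Γ₂ e_y ddΩᵀ, Γ₃ e_y dΩᵀ]`. -/
structure IsAdaptiveLoop (S : Signals m n) (N : Network m) (φ p q θ : Fin m → ℝ) (θ0 : ℝ)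
    (Γ : Fin 3 → Fin m → ℝ) (A : Matrix (Fin n) (Fin n) ℝ) (B c : Matrix (Fin n) (Fin m) ℝ) :
    Prop where
  leader_velocity : HasDerivOnTime S.x0 S.dx0
  leader_acceleration : HasDerivOnTime S.dx0 S.ddx0
  follower_velocity : HasDerivOnTime S.x S.dx
  filtered_acceleration : IsInverseLeadFiltered φ p q S.ddx0 S.ddΩ
  filtered_velocity : IsInverseLeadFiltered φ p q S.dx0 S.dΩ
  error_state : HasDerivOnTime S.ex (fun t => A *ᵥ S.ex t + B *ᵥ S.mismatch N θ θ0 t)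
  error_output : ∀ t, 0 ≤ t → S.ey N θ θ0 t = cᵀ *ᵥ S.ex t
  gradient_law : ∀ l i j, HasDerivOnTime (fun t => S.Ξ t l i j)
    (fun t => -(Matrix.diagonal (Γ l) *
      Matrix.vecMulVec (S.ey N θ θ0 t) (S.η N θ θ0 t l)) i j)

end Signals

end

end ShapedSync

open ShapedSync

namespace ShapedSync

noncomputable section

open Matrix Filter Topology

/-! ### Transfer functions of the channels -/

/-! All matrices in `W_w` are diagonal, so the frequency-domain part is scalar. A channel is
φ(s+p)(s+θ) over a cubic, and its inverse is (Js + e(s) + kφ)/φ with e bounded on a half plane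
reaching left of the imaginary axis. A large k makes the real part of this inverse positive, which
gives SPR.

The hard step is the Lyapunov pair for a realization that need not be minimal, so the textbook
Kalman-Yakubovich-Popov lemma for minimal triples is replaced by a duality argument. SPR is used
through four facts (`IsStrictlyPassive`): A is Hurwitz; cᵀB is diagonal and positive; cᵀAB has
negative definite Hermitian part; W has positive definite Hermitian part on the imaginary axis. The
second and third come from the expansion of W at infinity.

The symmetric P with PB = c include the affine family P₀ + QᵀRQ, where P₀ = c(cᵀB)⁻¹cᵀ and Q = 1 -
B(cᵀB)⁻¹cᵀ kills B. If no such P made PA negative definite, Hahn-Banach would give a positive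
semidefinite Z with tr(P₀AZ) ≥ 0 and QAZQᵀ skew. Writing Z = X² and diagonalizing the skew pencil
(`exists_orthonormalBasis_of_skew`) splits Z into modes x of two kinds: either Ax + Bv = iωx for
some v, or x = Bv. On a nonzero mode Re x*P₀Ax is negative, by positivity on the imaginary axis for
the first kind and by cᵀAB for the second (`IsStrictlyPassive.re_neg_of_mode`). As tr(P₀AZ) is the
sum of these numbers, Z = 0, a contradiction. Definiteness of P itself then follows from Hurwitz
stability (`IsHurwitz.posDef_of_lyapunov`).

For the adaptive loop, PB = c turns the indefinite term of the derivative of V into 2 e_yᵀΞη, which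
the gradient law cancels. Monotonicity of V gives the bounds and square integrability of e_x; a
Barbalat-type lemma gives convergence. Since the grounded Laplacian of the network is invertible,
e_y controls every y_i - y₀. -/

open Polynomial in
/-- Numerator of a channel of `W_w`. -/
def channelNum (φ p θ : ℝ) : ℝ[X] := C φ * (X + C p) * (X + C θ)

open Polynomial in
/-- Denominator of a channel of `W_w`. -/
def channelDen (J b φ p q θ k : ℝ) : ℝ[X] :=
  (C J * X ^ 2 + C b * X) * (X + C q) + C k * channelNum φ p θ

/-- A channel of `W_w`. -/
def channel (J b φ p q θ k : ℝ) : RatFunc ℝ :=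
  algebraMap _ _ (channelNum φ p θ) / algebraMap _ _ (channelDen J b φ p q θ k)

/-- The polynomial is a cubic with leading coefficient J, whatever the gain; this makes the
closed-loop pencil invertible for every k. -/
theorem channelDen_ne_zero {J : ℝ} (hJ : 0 < J) (b φ p q θ k : ℝ) :
    channelDen J b φ p q θ k ≠ 0 := by
  intro h
  have hc : ∀ c₂ c₁ c₀ : ℝ, (Polynomial.C J * Polynomial.X ^ 3 + Polynomial.C c₂ * Polynomial.X ^ 2
      + Polynomial.C c₁ * Polynomial.X + Polynomial.C c₀).coeff 3 = J := by
    intro c₂ c₁ c₀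
    simp
  have h3 : channelDen J b φ p q θ k =
      Polynomial.C J * Polynomial.X ^ 3 + Polynomial.C (J * q + b + k * φ) * Polynomial.X ^ 2
      + Polynomial.C (b * q + k * φ * (p + θ)) * Polynomial.X
      + Polynomial.C (k * φ * p * θ) := by
    simp only [channelDen, channelNum, map_add, map_mul]; ring
  have h4 := hc (J * q + b + k * φ) (b * q + k * φ * (p + θ)) (k * φ * p * θ)
  rw [← h3, h, Polynomial.coeff_zero] at h4
  linarith

/-- `RatFunc.eval` works in lowest terms. By coprimality the reduced denominator divides D, so it
cannot vanish where D does not, and N/D may be evaluated without cancelling common factors. -/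
theorem ratFunc_eval_eq_div {r : RatFunc ℝ} {N D : Polynomial ℝ}
    (h : r * algebraMap _ _ D = algebraMap _ _ N) {z : ℂ}
    (hD : D.eval₂ (algebraMap ℝ ℂ) z ≠ 0) :
    RatFunc.eval (algebraMap ℝ ℂ) z r =
      N.eval₂ (algebraMap ℝ ℂ) z / D.eval₂ (algebraMap ℝ ℂ) z := by
  have hden : algebraMap (Polynomial ℝ) (RatFunc ℝ) r.denom ≠ 0 :=
    RatFunc.algebraMap_ne_zero (RatFunc.denom_ne_zero r)
  have h1 : r * algebraMap _ _ r.denom = algebraMap _ _ r.num := by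
    conv_lhs => rw [← RatFunc.num_div_denom r]
    rw [RatFunc.num_div_denom r]
    nth_rewrite 1 [← RatFunc.num_div_denom r]
    field_simp
  have h2 : N * r.denom = r.num * D := by
    apply RatFunc.algebraMap_injective ℝ
    rw [map_mul, map_mul, ← h, ← h1]; ring
  have hdvd : r.denom ∣ D :=
    (RatFunc.isCoprime_num_denom r).symm.dvd_of_dvd_mul_left ⟨N, by rw [← h2]; ring⟩
  obtain ⟨g, hg⟩ := hdvd
  have hd : r.denom.eval₂ (algebraMap ℝ ℂ) z ≠ 0 := by
    intro h0
    rw [hg, Polynomial.eval₂_mul, h0, zero_mul] at hD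
    exact hD rfl
  have h3 := congrArg (Polynomial.eval₂ (algebraMap ℝ ℂ) z) h2
  rw [Polynomial.eval₂_mul, Polynomial.eval₂_mul] at h3
  rw [RatFunc.eval, div_eq_div_iff hd hD, ← h3]

theorem ratFunc_X_add_C_ne_zero (a : ℝ) : (RatFunc.X + RatFunc.C a : RatFunc ℝ) ≠ 0 := by
  have := RatFunc.algebraMap_ne_zero (Polynomial.X_add_C_ne_zero a)
  simpa using this

theorem inv_diagonal_of_ne_zero {m : ℕ} {d : Fin m → RatFunc ℝ} (hd : ∀ i, d i ≠ 0) :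
    (Matrix.diagonal d)⁻¹ = Matrix.diagonal fun i => (d i)⁻¹ := by
  apply Matrix.inv_eq_right_inv
  rw [Matrix.diagonal_mul_diagonal, ← Matrix.diagonal_one]
  congr 1
  funext i
  exact mul_inv_cancel₀ (hd i)

theorem leadController_eq {m : ℕ} (φ p q : Fin m → ℝ) :
    leadController φ p q = Matrix.diagonal fun i =>
      RatFunc.C (φ i) * (RatFunc.X + RatFunc.C (p i)) / (RatFunc.X + RatFunc.C (q i)) := by
  simp only [leadController, diagGain, sId, Matrix.diagonal_add]
  rw [inv_diagonal_of_ne_zero fun i => ratFunc_X_add_C_ne_zero (q i)]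
  simp only [Matrix.diagonal_mul_diagonal, div_eq_mul_inv]

theorem algebraMap_channelDen (J b φ p q θ k : ℝ) :
    algebraMap (Polynomial ℝ) (RatFunc ℝ) (channelDen J b φ p q θ k) =
      (RatFunc.C J * RatFunc.X ^ 2 + RatFunc.C b * RatFunc.X
        + RatFunc.C k * (RatFunc.C φ * (RatFunc.X + RatFunc.C p) / (RatFunc.X + RatFunc.C q))
          * (RatFunc.X + RatFunc.C θ)) * (RatFunc.X + RatFunc.C q) := by
  have := ratFunc_X_add_C_ne_zero q
  simp only [channelDen, channelNum, map_add, map_mul, map_pow, RatFunc.algebraMap_C,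
    RatFunc.algebraMap_X]
  field_simp

theorem closedLoop_ne_zero {J : ℝ} (hJ : 0 < J) (b φ p q θ k : ℝ) :
    (RatFunc.C J * RatFunc.X ^ 2 + RatFunc.C b * RatFunc.X
        + RatFunc.C k * (RatFunc.C φ * (RatFunc.X + RatFunc.C p) / (RatFunc.X + RatFunc.C q))
          * (RatFunc.X + RatFunc.C θ) : RatFunc ℝ) ≠ 0 := by
  intro h
  have h1 := algebraMap_channelDen J b φ p q θ k
  rw [h, zero_mul] at h1
  exact RatFunc.algebraMap_ne_zero (channelDen_ne_zero hJ b φ p q θ k) h1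

theorem shapedTransfer_eq {m : ℕ} {J : Fin m → ℝ} (hJ : ∀ i, 0 < J i) (b φ p q θ k : Fin m → ℝ) :
    shapedTransfer J b φ p q θ k =
      Matrix.diagonal fun i => channel (J i) (b i) (φ i) (p i) (q i) (θ i) (k i) := by
  simp only [shapedTransfer, closedLoopPencil, leadController_eq, diagGain, sId,
    Matrix.diagonal_add, Matrix.diagonal_mul_diagonal, Matrix.diagonal_pow, Pi.pow_def]
  rw [inv_diagonal_of_ne_zero fun i => closedLoop_ne_zero (hJ i) _ _ _ _ _ _,
    Matrix.diagonal_mul_diagonal]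
  congr 1
  funext i
  rw [channel, algebraMap_channelDen]
  have h1 := closedLoop_ne_zero (hJ i) (b i) (φ i) (p i) (q i) (θ i) (k i)
  have h2 := ratFunc_X_add_C_ne_zero (q i)
  simp only [channelNum, map_add, map_mul, RatFunc.algebraMap_C, RatFunc.algebraMap_X]
  rw [← div_eq_mul_inv, div_eq_div_iff h1 (mul_ne_zero h1 h2)]
  generalize (RatFunc.C (J i) * RatFunc.X ^ 2 + RatFunc.C (b i) * RatFunc.X + _ : RatFunc ℝ) = d
  field_simp

theorem closedLoop_transfer {m : ℕ} {J : Fin m → ℝ} (hJ : ∀ i, 0 < J i)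
    (b φ p q θ k : Fin m → ℝ) (r x y : Fin m → RatFunc ℝ)
    (hy : y = Matrix.mulVec (sId m + diagGain θ) x)
    (hx : Matrix.mulVec (diagGain J * sId m ^ 2 + diagGain b * sId m) x =
      Matrix.mulVec (leadController φ p q) (r - Matrix.mulVec (diagGain k) y)) :
    y = Matrix.mulVec (shapedTransfer J b φ p q θ k) r := by
  rw [shapedTransfer_eq hJ]
  rw [leadController_eq] at hx
  simp only [diagGain, sId, Matrix.diagonal_add, Matrix.diagonal_mul_diagonal,
    Matrix.diagonal_pow, Pi.pow_def] at hx hy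
  funext i
  have hyi := congrFun hy i
  have hxi := congrFun hx i
  simp only [Matrix.mulVec_diagonal, Pi.sub_apply] at hyi hxi ⊢
  have h0 := RatFunc.algebraMap_ne_zero
    (channelDen_ne_zero (hJ i) (b i) (φ i) (p i) (q i) (θ i) (k i))
  have h2 := ratFunc_X_add_C_ne_zero (q i)
  rw [channel, div_mul_eq_mul_div, eq_div_iff h0]
  simp only [channelDen, channelNum, map_add, map_mul, map_pow, RatFunc.algebraMap_C,
    RatFunc.algebraMap_X]
  field_simp at hxi
  -- The loop equation times s + θ still contains x; the output relation times (Js² + bs)(s + q)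
  -- eliminates it.
  linear_combination
    ((RatFunc.C (J i) * RatFunc.X ^ 2 + RatFunc.C (b i) * RatFunc.X)
      * (RatFunc.X + RatFunc.C (q i))) * hyi + (RatFunc.X + RatFunc.C (θ i)) * hxi

/-! ### Values of a channel -/

theorem eval₂_channelNum (φ p θ : ℝ) (z : ℂ) :
    (channelNum φ p θ).eval₂ (algebraMap ℝ ℂ) z = φ * (z + p) * (z + θ) := by
  simp [channelNum, Polynomial.eval₂_mul, Polynomial.eval₂_add]

theorem eval₂_channelDen (J b φ p q θ k : ℝ) (z : ℂ) :
    (channelDen J b φ p q θ k).eval₂ (algebraMap ℝ ℂ) z =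
      (J * z ^ 2 + b * z) * (z + q) + k * (φ * (z + p) * (z + θ)) := by
  simp [channelDen, ← eval₂_channelNum, Polynomial.eval₂_mul, Polynomial.eval₂_add]

theorem eval_channel {J : ℝ} (hJ : 0 < J) {b φ p q θ k : ℝ} {z : ℂ}
    (hz : ((J * z ^ 2 + b * z) * (z + q) + k * (φ * (z + p) * (z + θ)) : ℂ) ≠ 0) :
    RatFunc.eval (algebraMap ℝ ℂ) z (channel J b φ p q θ k) =
      φ * (z + p) * (z + θ) / ((J * z ^ 2 + b * z) * (z + q) + k * (φ * (z + p) * (z + θ))) := by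
  rw [ratFunc_eval_eq_div (D := channelDen J b φ p q θ k) (N := channelNum φ p θ) _ _,
    eval₂_channelNum, eval₂_channelDen]
  · rw [channel, div_mul_cancel₀]
    exact RatFunc.algebraMap_ne_zero (channelDen_ne_zero hJ b φ p q θ k)
  · rwa [eval₂_channelDen]

/-! ### Strict positive realness of a diagonal transfer matrix -/

theorem evalAt_diagonal {m : ℕ} (d : Fin m → RatFunc ℝ) (z : ℂ) :
    evalAt (Matrix.diagonal d) z =
      Matrix.diagonal fun i => RatFunc.eval (algebraMap ℝ ℂ) z (d i) := by
  ext i j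
  by_cases h : i = j
  · subst h; simp [evalAt]
  · simp [evalAt, Matrix.diagonal_apply_ne _ h]

theorem isOpen_re_gt (a : ℝ) : IsOpen {z : ℂ | a < z.re} :=
  isOpen_lt continuous_const Complex.continuous_re

open scoped ComplexOrder in
theorem posSemidef_diagonal_add_conjTranspose_iff {m : ℕ} (d : Fin m → ℂ) :
    (Matrix.diagonal d + (Matrix.diagonal d)ᴴ).PosSemidef ↔ ∀ i, 0 ≤ (d i).re := by
  rw [Matrix.diagonal_conjTranspose, Matrix.diagonal_add, Matrix.posSemidef_diagonal_iff]
  refine forall_congr' fun i => ?_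
  rw [Pi.star_apply, Complex.le_def]
  simp

/-- The shift by ε is moved from the argument to the domain, leaving scalar conditions on one half
plane shared by all channels. -/
theorem isSPR_diagonal_iff {m : ℕ} (d : Fin m → RatFunc ℝ) :
    IsSPR (Matrix.diagonal d) ↔ ∃ ε : ℝ, 0 < ε ∧ ∀ i,
      AnalyticOnNhd ℂ (fun z => RatFunc.eval (algebraMap ℝ ℂ) z (d i)) {z : ℂ | -ε < z.re} ∧
      ∀ z : ℂ, -ε < z.re → 0 ≤ (RatFunc.eval (algebraMap ℝ ℂ) z (d i)).re := by
  constructor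
  · rintro ⟨ε, hε, ha, hp⟩
    refine ⟨ε, hε, fun i => ⟨?_, ?_⟩⟩
    · have h1 := (ha i i).comp (f := fun z : ℂ => z + ε) (s := {z : ℂ | -ε < z.re})
        (t := {z : ℂ | 0 < z.re}) (fun z _ => by fun_prop) (fun z hz => by
          simp only [Set.mem_ofPred_eq, Complex.add_re, Complex.ofReal_re] at hz ⊢; linarith)
      refine h1.congr (isOpen_re_gt _) fun z _ => ?_
      simp [evalAt_diagonal]
    · intro z hz
      have h1 := hp (z + ε) (by simp; linarith)
      simp only [evalAt_diagonal, add_sub_cancel_right] at h1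
      exact (posSemidef_diagonal_add_conjTranspose_iff _).1 h1 i
  · rintro ⟨ε, hε, h⟩
    refine ⟨ε, hε, ?_, ?_⟩
    · intro i j
      simp only [evalAt_diagonal]
      by_cases hij : i = j
      · subst hij
        simp only [Matrix.diagonal_apply_eq]
        exact (h i).1.comp (g := fun z : ℂ => RatFunc.eval (algebraMap ℝ ℂ) z (d i))
          (f := fun z : ℂ => z - ε) (fun z _ => by fun_prop) (fun z hz => by
            simp only [Set.mem_ofPred_eq, Complex.sub_re, Complex.ofReal_re] at hz ⊢; linarith)
      · simp only [Matrix.diagonal_apply_ne _ hij]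
        exact analyticOnNhd_const
    · intro z hz
      simp only [evalAt_diagonal]
      rw [posSemidef_diagonal_add_conjTranspose_iff]
      intro i
      exact (h i).2 _ (by simp; linarith)

theorem le_norm_add_of_re {z : ℂ} {a : ℝ} (hz : -(a / 2) < z.re) :
    a / 2 ≤ ‖z + a‖ := by
  have := Complex.re_le_norm (z + a)
  simp only [Complex.add_re, Complex.ofReal_re] at this
  linarith

theorem norm_inv_add_le {z : ℂ} {a : ℝ} (ha : 0 < a) (hz : -(a / 2) < z.re) :
    ‖(z + a)⁻¹‖ ≤ 2 / a := by
  have := le_norm_add_of_re hz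
  rw [norm_inv, ← inv_div]
  exact inv_anti₀ (by positivity) this

theorem add_ne_zero_of_re {z : ℂ} {a : ℝ} (ha : 0 < a) (hz : -(a / 2) < z.re) :
    z + (a : ℂ) ≠ 0 := by
  have := le_norm_add_of_re hz
  rw [← norm_pos_iff]
  linarith

/-- A complex number and its inverse have real parts of the same sign, so the inverse channel is
bounded below instead. The output zero s + θ lowers the relative degree to one, so that only the
linear term Js is unbounded. -/
theorem exists_gain_channel_positive {J φ p θ : ℝ} (b q : ℝ) (hJ : 0 < J) (hφ : 0 < φ) (hp : 0 < p)
    (hθ : 0 < θ) : ∃ κ ε : ℝ, 0 < ε ∧ ∀ k : ℝ, κ ≤ k → ∀ z : ℂ, -ε < z.re →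
      ((J * z ^ 2 + b * z) * (z + q) + k * (φ * (z + p) * (z + θ)) : ℂ) ≠ 0 ∧
      0 ≤ (φ * (z + p) * (z + θ) /
        ((J * z ^ 2 + b * z) * (z + q) + k * (φ * (z + p) * (z + θ))) : ℂ).re := by
  -- With u = 1/(z+p) and v = 1/(z+θ), one has z/(z+p) = 1 - pu and (z+q)/(z+θ) = 1 + (q-θ)v. Hence
  -- z(Jz+b)(z+q)/((z+p)(z+θ)) = Jz + E(u, v) with E polynomial, so bounded by some K when u and v
  -- range over closed balls.
  let E : ℂ × ℂ → ℂ := fun w => b + J * (-p * (1 - p * w.1) + (q - θ) * (1 - θ * w.2)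
    - p * (q - θ) * (1 - p * w.1) * w.2) + b * (-p * w.1 + (q - θ) * w.2 - p * (q - θ) * w.1 * w.2)
  have hE : Continuous E := by fun_prop
  obtain ⟨K, hK⟩ := ((isCompact_closedBall (0 : ℂ) (2 / p)).prod
    (isCompact_closedBall (0 : ℂ) (2 / θ))).exists_bound_of_continuousOn hE.continuousOn
  -- This κ gives Re(Jz + e + kφ) > 1: Jz loses at most J min(p,θ)/2 on the half plane and e loses
  -- at most K.
  refine ⟨(J * (min p θ / 2) + K + 1) / φ, min p θ / 2, by positivity, fun k hk z hz => ?_⟩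
  have hzp : -(p / 2) < z.re := by have := min_le_left p θ; linarith
  have hzθ : -(θ / 2) < z.re := by have := min_le_right p θ; linarith
  have hu := add_ne_zero_of_re hp hzp
  have hv := add_ne_zero_of_re hθ hzθ
  have hb := hK ((z + p)⁻¹, (z + θ)⁻¹) ⟨by simpa using norm_inv_add_le hp hzp,
    by simpa using norm_inv_add_le hθ hzθ⟩
  set e := E ((z + p)⁻¹, (z + θ)⁻¹) with he
  have hD : ((J * z ^ 2 + b * z) * (z + q) + k * (φ * (z + p) * (z + θ)) : ℂ) =
      (z + p) * (z + θ) * (J * z + e + k * φ) := by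
    rw [he]
    simp only [E]
    field_simp
    ring
  have hre : 0 < (J * z + e + k * φ : ℂ).re := by
    rw [div_le_iff₀ hφ] at hk
    have h1 := (abs_le.1 ((Complex.abs_re_le_norm e).trans hb)).1
    have h2 : (J * z + e + k * φ : ℂ).re = J * z.re + e.re + k * φ := by simp
    rw [h2]
    nlinarith
  have hne : (J * z + e + k * φ : ℂ) ≠ 0 := by
    intro h; rw [h] at hre; simp at hre
  rw [hD]
  refine ⟨mul_ne_zero (mul_ne_zero hu hv) hne, ?_⟩
  have : (φ * (z + p) * (z + θ) / ((z + p) * (z + θ) * (J * z + e + k * φ)) : ℂ)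
      = φ * (J * z + e + k * φ)⁻¹ := by
    field_simp
  rw [this, Complex.re_ofReal_mul, Complex.inv_re]
  have := Complex.normSq_nonneg (J * z + e + k * φ : ℂ)
  positivity

theorem exists_gain_isSPR {m : ℕ} {J φ p θ : Fin m → ℝ} (b q : Fin m → ℝ) (hJ : ∀ i, 0 < J i)
    (hφ : ∀ i, 0 < φ i) (hp : ∀ i, 0 < p i) (hθ : ∀ i, 0 < θ i) :
    ∃ κ : ℝ, ∀ k : Fin m → ℝ, (∀ i, κ ≤ k i) → IsSPR (shapedTransfer J b φ p q θ k) := by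
  choose κ ε hε h using fun i =>
    exists_gain_channel_positive (b i) (q i) (hJ i) (hφ i) (hp i) (hθ i)
  obtain ⟨κ', hκ'⟩ := (Set.finite_range κ).bddAbove
  -- A common shift comes from an upper bound on the inverses; the maximum with 1 keeps it positive
  -- even when there are no channels.
  have hmin : ∃ δ : ℝ, 0 < δ ∧ ∀ i, δ ≤ ε i := by
    obtain ⟨M, hM⟩ := (Set.finite_range fun i => (ε i)⁻¹).bddAbove
    refine ⟨(max M 1)⁻¹, by positivity, fun i => ?_⟩
    have h1 : (ε i)⁻¹ ≤ max M 1 := (hM ⟨i, rfl⟩).trans (le_max_left _ _)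
    exact inv_le_of_inv_le₀ (hε i) h1
  obtain ⟨δ, hδ, hδε⟩ := hmin
  refine ⟨κ', fun k hk => ?_⟩
  rw [shapedTransfer_eq hJ, isSPR_diagonal_iff]
  refine ⟨δ, hδ, fun i => ?_⟩
  have hi : ∀ z : ℂ, -δ < z.re → _ := fun z hz =>
    h i (k i) ((hκ' ⟨i, rfl⟩).trans (hk i)) z (by linarith [hδε i])
  constructor
  · have h1 : AnalyticOnNhd ℂ (fun z : ℂ => (φ i * (z + p i) * (z + θ i) /
        ((J i * z ^ 2 + b i * z) * (z + q i) + k i * (φ i * (z + p i) * (z + θ i))) : ℂ))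
        {z : ℂ | -δ < z.re} := by
      intro z hz
      refine AnalyticAt.fun_div ?_ ?_ (hi z hz).1 <;> fun_prop
    exact h1.congr (isOpen_re_gt _) fun z hz => (eval_channel (hJ i) (hi z hz).1).symm
  · intro z hz
    rw [eval_channel (hJ i) (hi z hz).1]
    exact (hi z hz).2

/-! ### Transfer matrix of a realization -/

/-- Complexification of a real matrix. -/
abbrev toC {a b : ℕ} (M : Matrix (Fin a) (Fin b) ℝ) : Matrix (Fin a) (Fin b) ℂ :=
  M.map (algebraMap ℝ ℂ)

theorem sId_sub_map_C {n : ℕ} (A : Matrix (Fin n) (Fin n) ℝ) :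
    sId n - A.map RatFunc.C = (charmatrix A).map (algebraMap (Polynomial ℝ) (RatFunc ℝ)) := by
  ext i j
  by_cases h : i = j
  · subst h; simp [sId]
  · simp [sId, h]

/-- Cramer's rule for the resolvent. It writes each entry of W as a polynomial over the
characteristic polynomial, the form needed to evaluate it off the spectrum of A. -/
theorem transfer_mul_charpoly {m n : ℕ} (A : Matrix (Fin n) (Fin n) ℝ)
    (B c : Matrix (Fin n) (Fin m) ℝ) (i j : Fin m) :
    (cᵀ.map RatFunc.C * (sId n - A.map RatFunc.C)⁻¹ * B.map RatFunc.C) i j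
        * algebraMap (Polynomial ℝ) (RatFunc ℝ) A.charpoly =
      algebraMap _ _ ((cᵀ.map Polynomial.C * adjugate (charmatrix A) * B.map Polynomial.C) i j) := by
  have hχ : algebraMap (Polynomial ℝ) (RatFunc ℝ) A.charpoly ≠ 0 :=
    RatFunc.algebraMap_ne_zero (charpoly_monic A).ne_zero
  have hdet : (sId n - A.map RatFunc.C).det = algebraMap _ _ A.charpoly := by
    rw [sId_sub_map_C, charpoly, RingHom.map_det]; rfl
  have hadj : (sId n - A.map RatFunc.C).adjugate =
      (adjugate (charmatrix A)).map (algebraMap _ _) := by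
    rw [sId_sub_map_C]
    exact ((algebraMap (Polynomial ℝ) (RatFunc ℝ)).map_adjugate _).symm
  rw [inv_def, hdet, hadj, Ring.inverse_eq_inv', Matrix.mul_smul, Matrix.smul_mul,
    Matrix.smul_apply, smul_eq_mul, mul_comm, mul_inv_cancel_left₀ hχ]
  have h1 : ∀ {a b : ℕ} (M : Matrix (Fin a) (Fin b) ℝ), M.map RatFunc.C =
      (M.map Polynomial.C).map (algebraMap (Polynomial ℝ) (RatFunc ℝ)) := by
    intro a b M; ext i j; simp
  rw [h1, h1, ← Matrix.map_mul, ← Matrix.map_mul, Matrix.map_apply]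

theorem charmatrix_map_eval₂ {n : ℕ} (A : Matrix (Fin n) (Fin n) ℝ) (z : ℂ) :
    (charmatrix A).map (Polynomial.eval₂RingHom (algebraMap ℝ ℂ) z) = z • 1 - toC A := by
  ext i j
  by_cases h : i = j
  · subst h; simp
  · simp [h]

theorem evalAt_realization {m n : ℕ} {W : Matrix (Fin m) (Fin m) (RatFunc ℝ)}
    {A : Matrix (Fin n) (Fin n) ℝ} {B c : Matrix (Fin n) (Fin m) ℝ}
    (h : W = cᵀ.map RatFunc.C * (sId n - A.map RatFunc.C)⁻¹ * B.map RatFunc.C) {z : ℂ}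
    (hz : (z • 1 - toC A).det ≠ 0) :
    evalAt W z = (toC c)ᵀ * (z • 1 - toC A)⁻¹ * toC B := by
  set e := Polynomial.eval₂RingHom (algebraMap ℝ ℂ) z with he
  have hdet : e A.charpoly = (z • 1 - toC A).det := by
    rw [charpoly, RingHom.map_det, ← charmatrix_map_eval₂]; rfl
  have hadj : (adjugate (charmatrix A)).map e = adjugate (z • 1 - toC A) := by
    rw [← charmatrix_map_eval₂]
    exact e.map_adjugate _
  have h1 : ∀ {a b : ℕ} (M : Matrix (Fin a) (Fin b) ℝ), toC M = (M.map Polynomial.C).map e := by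
    intro a b M; ext i j; simp [e]
  ext i j
  have h2 := transfer_mul_charpoly A B c i j
  rw [← h] at h2
  have hχ : Polynomial.eval₂ (algebraMap ℝ ℂ) z A.charpoly ≠ 0 := by
    change e A.charpoly ≠ 0
    rwa [hdet]
  have h3 := ratFunc_eval_eq_div h2 hχ
  rw [evalAt, Matrix.of_apply, h3, inv_def, Ring.inverse_eq_inv', Matrix.mul_smul,
    Matrix.smul_mul, Matrix.smul_apply, smul_eq_mul, ← hdet, ← hadj, h1 B, h1 c,
    ← Matrix.transpose_map, ← Matrix.map_mul, ← Matrix.map_mul, Matrix.map_apply, inv_mul_eq_div,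
    Matrix.transpose_map]
  rfl

theorem IsHurwitz.det_ne_zero {n : ℕ} {A : Matrix (Fin n) (Fin n) ℝ} (hA : IsHurwitz A) {z : ℂ}
    (hz : 0 ≤ z.re) : (z • 1 - toC A).det ≠ 0 := by
  intro h
  have h1 : z ∈ spectrum ℂ (toC A) := by
    rw [spectrum.mem_iff, Algebra.algebraMap_eq_smul_one, Matrix.isUnit_iff_isUnit_det, h]
    simp
  exact absurd (hA z h1) (not_lt.2 hz)

theorem IsHurwitz.eq_zero_of_mulVec {n : ℕ} {A : Matrix (Fin n) (Fin n) ℝ} (hA : IsHurwitz A)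
    {z : ℂ} (hz : 0 ≤ z.re) {x : Fin n → ℂ} (hx : toC A *ᵥ x = z • x) : x = 0 := by
  by_contra hx0
  refine hA.det_ne_zero hz (Matrix.exists_mulVec_eq_zero_iff.1 ⟨x, hx0, ?_⟩)
  rw [Matrix.sub_mulVec, hx, Matrix.smul_mulVec, Matrix.one_mulVec, sub_self]

/-- Expansion of the transfer matrix of a realization at infinity. -/
theorem evalAt_realization_expansion {m n : ℕ} {W : Matrix (Fin m) (Fin m) (RatFunc ℝ)}
    {A : Matrix (Fin n) (Fin n) ℝ} {B c : Matrix (Fin n) (Fin m) ℝ}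
    (h : W = cᵀ.map RatFunc.C * (sId n - A.map RatFunc.C)⁻¹ * B.map RatFunc.C) (i j : Fin m) :
    ∃ g : ℂ → ℂ, ContinuousAt g 0 ∧ ∀ᶠ t in 𝓝[≠] (0 : ℂ), evalAt W t⁻¹ i j =
      t * ((cᵀ * B) i j : ℝ) + t ^ 2 * ((cᵀ * A * B) i j : ℝ) + t ^ 3 * g t := by
  have hR : Continuous fun t : ℂ => (1 - t • toC A : Matrix (Fin n) (Fin n) ℂ) := by fun_prop
  have hdet : ∀ᶠ t in 𝓝 (0 : ℂ), (1 - t • toC A).det ≠ 0 :=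
    hR.matrix_det.continuousAt.eventually_ne (by simp)
  have hinv : ContinuousAt (fun t : ℂ => (1 - t • toC A)⁻¹) 0 := by
    simp only [inv_def, Ring.inverse_eq_inv']
    exact (hR.matrix_det.continuousAt.inv₀ (by simp)).smul hR.matrix_adjugate.continuousAt
  -- With t = 1/s the resolvent of A is t(1 - tA)⁻¹, and (1 - tA)⁻¹ = 1 + tA + t²A²(1 - tA)⁻¹. The
  -- first two terms give the Markov parameters cᵀB and cᵀAB.
  refine ⟨fun t => ((toC c)ᵀ * (toC A * toC A * (1 - t • toC A)⁻¹) * toC B) i j, ?_, ?_⟩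
  · have hc : Continuous fun S : Matrix (Fin n) (Fin n) ℂ =>
        ((toC c)ᵀ * (toC A * toC A * S) * toC B) i j := by
      refine Continuous.matrix_elem ?_ i j
      fun_prop
    exact hc.continuousAt.comp hinv
  · filter_upwards [nhdsWithin_le_nhds hdet, self_mem_nhdsWithin] with t ht ht0
    have ht0 : t ≠ 0 := ht0
    set S := (1 - t • toC A)⁻¹ with hS
    have hu : IsUnit (1 - t • toC A).det := isUnit_iff_ne_zero.2 ht
    have hS1 : S = 1 + t • (toC A * S) := by
      have := Matrix.mul_nonsing_inv _ hu
      rw [← hS, Matrix.sub_mul, Matrix.one_mul, Matrix.smul_mul] at this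
      rw [← this]; abel
    have hS2 : S = 1 + t • toC A + t ^ 2 • (toC A * toC A * S) := by
      conv_lhs => rw [hS1, hS1]
      rw [Matrix.mul_add, Matrix.mul_one, Matrix.mul_smul, smul_add, smul_smul, ← Matrix.mul_assoc,
        sq, add_assoc]
    have hfac : (t⁻¹ • 1 - toC A : Matrix (Fin n) (Fin n) ℂ) = t⁻¹ • (1 - t • toC A) := by
      rw [smul_sub, smul_smul, inv_mul_cancel₀ ht0, one_smul]
    have hres : (t⁻¹ • 1 - toC A : Matrix (Fin n) (Fin n) ℂ)⁻¹ = t • S := by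
      apply Matrix.inv_eq_right_inv
      rw [hfac, Matrix.smul_mul, Matrix.mul_smul, smul_smul, inv_mul_cancel₀ ht0, one_smul]
      exact Matrix.mul_nonsing_inv _ hu
    rw [evalAt_realization h (by
      rw [hfac, det_smul]
      exact mul_ne_zero (pow_ne_zero _ (inv_ne_zero ht0)) ht), hres]
    conv_lhs => rw [hS2]
    have h1 : ((toC c)ᵀ * toC B) i j = (((cᵀ * B) i j : ℝ) : ℂ) := by
      rw [← Matrix.transpose_map, ← Matrix.map_mul]; rfl
    have h2 : ((toC c)ᵀ * toC A * toC B) i j = (((cᵀ * A * B) i j : ℝ) : ℂ) := by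
      rw [← Matrix.transpose_map, ← Matrix.map_mul, ← Matrix.map_mul]; rfl
    rw [← h1, ← h2]
    simp only [Matrix.mul_smul, Matrix.smul_mul, Matrix.mul_add, Matrix.add_mul, Matrix.mul_one,
      Matrix.smul_apply, Matrix.add_apply, smul_eq_mul]
    ring

/-! ### Frequency-domain consequences of strict positive realness -/

/-- Divide by t, let t tend to 0, and repeat with t². A general filter is allowed so that the
comparison can also be made along the positive real axis. -/
theorem expansion_coeff_unique {f g g' : ℂ → ℂ} {h h' a a' : ℂ} (hg : ContinuousAt g 0)
    (hg' : ContinuousAt g' 0) {l : Filter ℂ} [l.NeBot] (hl : l ≤ 𝓝[≠] (0 : ℂ))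
    (e : ∀ᶠ t in l, f t = t * h + t ^ 2 * a + t ^ 3 * g t)
    (e' : ∀ᶠ t in l, f t = t * h' + t ^ 2 * a' + t ^ 3 * g' t) : h = h' ∧ a = a' := by
  have hne : ∀ᶠ t in l, t ≠ 0 := hl self_mem_nhdsWithin
  have hl0 : l ≤ 𝓝 0 := hl.trans nhdsWithin_le_nhds
  have key : ∀ (u u' : ℂ → ℂ), ContinuousAt u 0 → ContinuousAt u' 0 →
      (∀ᶠ t in l, u t = u' t) → u 0 = u' 0 := by
    intro u u' hu hu' huu
    exact tendsto_nhds_unique_of_eventuallyEq (hu.tendsto.mono_left hl0)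
      (hu'.tendsto.mono_left hl0) huu
  have h1 : h = h' := by
    have := key (fun t => h + t * a + t ^ 2 * g t) (fun t => h' + t * a' + t ^ 2 * g' t)
      (by fun_prop) (by fun_prop) (by
        filter_upwards [e, e', hne] with t h1 h2 h3
        apply mul_left_cancel₀ h3
        linear_combination h2 - h1)
    simpa using this
  refine ⟨h1, ?_⟩
  have := key (fun t => a + t * g t) (fun t => a' + t * g' t)
      (by fun_prop) (by fun_prop) (by
        filter_upwards [e, e', hne] with t h4 h2 h3
        apply mul_left_cancel₀ (pow_ne_zero 2 h3)
        subst h1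
        linear_combination h2 - h4)
  simpa using this

/-- A function that is positive real to the right of `-ε` has a negative second coefficient at
infinity as soon as the first one is positive. -/
theorem second_coeff_neg {f g : ℂ → ℂ} {h a ε : ℝ} (hg : ContinuousAt g 0) (hh : 0 < h)
    (hε : 0 < ε) (e : ∀ᶠ t in 𝓝[≠] (0 : ℂ), f t⁻¹ = t * h + t ^ 2 * a + t ^ 3 * g t)
    (hf : ∀ z : ℂ, -ε < z.re → 0 ≤ (f z).re) : a < 0 := by
  -- On the vertical line Re z = -δ one has conj z = -2δ - z, so |z|² Re f(z) tends to -δh - a as Im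
  -- z grows. This limit is nonnegative, hence a ≤ -δh < 0.
  set δ := ε / 2 with hδ
  let z : ℝ → ℂ := fun ω => ⟨-δ, ω⟩
  have hz : Tendsto z atTop (Bornology.cobounded ℂ) := by
    rw [← tendsto_norm_atTop_iff_cobounded]
    refine tendsto_atTop_mono (fun ω => ?_) tendsto_id
    exact (le_abs_self ω).trans (Complex.abs_im_le_norm (z ω))
  have ht : Tendsto (fun ω => (z ω)⁻¹) atTop (𝓝[≠] 0) :=
    tendsto_nhdsWithin_iff.2 ⟨tendsto_inv₀_cobounded.comp hz, Eventually.of_forall fun ω =>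
      inv_ne_zero fun h => by
        have := congrArg Complex.re h
        simp only [z, Complex.zero_re] at this
        linarith⟩
  have ht0 : Tendsto (fun ω => (z ω)⁻¹) atTop (𝓝 0) := ht.mono_right nhdsWithin_le_nhds
  have hF : ContinuousAt (fun t : ℂ => -δ * h + (-1 - 2 * δ * t) * (a + t * g t)) 0 := by fun_prop
  have hlim := (Complex.continuous_re.tendsto _).comp (hF.tendsto.comp ht0)
  have hpos : ∀ᶠ ω in atTop, 0 ≤ (-δ * h + (-1 - 2 * δ * (z ω)⁻¹)
      * (a + (z ω)⁻¹ * g (z ω)⁻¹) : ℂ).re := by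
    filter_upwards [ht.eventually e, ht self_mem_nhdsWithin] with ω h1 h2
    have hz0 : z ω ≠ 0 := fun h => h2 (by simp [h])
    rw [inv_inv] at h1
    have h3 := mul_nonneg (Complex.normSq_nonneg (z ω)) (hf (z ω) (by simp [z, hδ]; linarith))
    rw [← Complex.re_ofReal_mul, ← Complex.mul_conj, h1] at h3
    have hconj : (starRingEnd ℂ) (z ω) = -2 * δ - z ω := by
      apply Complex.ext <;> simp [z]; ring
    have h4 : (z ω * (starRingEnd ℂ) (z ω) * ((z ω)⁻¹ * h + (z ω)⁻¹ ^ 2 * a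
        + (z ω)⁻¹ ^ 3 * g (z ω)⁻¹) : ℂ) = (-2 * δ - z ω) * h
          + (-1 - 2 * δ * (z ω)⁻¹) * (a + (z ω)⁻¹ * g (z ω)⁻¹) := by
      rw [hconj]; field_simp; ring
    rw [h4, Complex.add_re] at h3
    rw [Complex.add_re]
    have h5 : ((-2 * δ - z ω) * h : ℂ).re = (-δ * h : ℂ).re := by
      simp [z]; ring
    rwa [h5] at h3
  have hge := ge_of_tendsto hlim hpos
  simp at hge
  nlinarith

/-- By the open mapping theorem the image of a nonconstant f is open, so it lies in the interior of
the closed right half plane. -/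
theorem re_pos_of_re_nonneg {f : ℂ → ℂ} {ε : ℝ} (ha : AnalyticOnNhd ℂ f {z : ℂ | -ε < z.re})
    (hf : ∀ z : ℂ, -ε < z.re → 0 ≤ (f z).re)
    (hne : ¬ ∃ w, ∀ z : ℂ, -ε < z.re → f z = w) {z : ℂ} (hz : -ε < z.re) : 0 < (f z).re := by
  have hconn : IsPreconnected {z : ℂ | -ε < z.re} :=
    (convex_halfSpace_re_gt (-ε)).isPreconnected
  rcases ha.is_constant_or_isOpen hconn with h | h
  · exact absurd h hne
  · have h1 : IsOpen (f '' {z : ℂ | -ε < z.re}) := h _ subset_rfl (isOpen_re_gt _)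
    have h2 : f '' {z : ℂ | -ε < z.re} ⊆ interior {w : ℂ | 0 ≤ w.re} :=
      interior_maximal (by rintro _ ⟨w, hw, rfl⟩; exact hf w hw) h1
    rw [Complex.interior_setOfPred_le_re] at h2
    exact h2 ⟨z, hz, rfl⟩

/-- A channel behaves like φ/(Js) at infinity; this identifies the diagonal of cᵀB in any
realization. -/
theorem tendsto_channel_div {J : ℝ} (hJ : 0 < J) (b φ p q θ k : ℝ) :
    Tendsto (fun t : ℂ => RatFunc.eval (algebraMap ℝ ℂ) t⁻¹ (channel J b φ p q θ k) / t)
      (𝓝[≠] 0) (𝓝 (φ / J : ℝ)) := by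
  let D : ℂ → ℂ := fun t => (J + b * t) * (1 + q * t) + k * t * (φ * (1 + p * t) * (1 + θ * t))
  have hD : Continuous D := by fun_prop
  have hJ' : (J : ℂ) ≠ 0 := by exact_mod_cast hJ.ne'
  have hD0 : D 0 = J := by simp [D]
  have hev : ∀ᶠ t in 𝓝 (0 : ℂ), D t ≠ 0 := hD.continuousAt.eventually_ne (by rwa [hD0])
  have hF : ContinuousAt (fun t : ℂ => φ * (1 + p * t) * (1 + θ * t) / D t) 0 :=
    ContinuousAt.div (by fun_prop) hD.continuousAt (by rwa [hD0])
  have hF0 := hF.tendsto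
  simp only [hD0, mul_zero, add_zero, mul_one] at hF0
  rw [Complex.ofReal_div]
  refine (hF0.mono_left nhdsWithin_le_nhds).congr' ?_
  filter_upwards [nhdsWithin_le_nhds hev, self_mem_nhdsWithin] with t h1 h2
  have h2 : t ≠ 0 := h2
  have h3 : ((J * t⁻¹ ^ 2 + b * t⁻¹) * (t⁻¹ + q) + k * (φ * (t⁻¹ + p) * (t⁻¹ + θ)) : ℂ)
      = t⁻¹ ^ 3 * D t := by
    simp only [D]; field_simp
  rw [eval_channel hJ (by rw [h3]; exact mul_ne_zero (pow_ne_zero _ (inv_ne_zero h2)) h1), h3]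
  field_simp

/-- Constancy is only known on the half plane, so the expansion is read for t = 1/s with s real and
positive: a constant would have to be 0, forcing h = 0. -/
theorem not_const_of_expansion {f g : ℂ → ℂ} {h a ε : ℝ} (hg : ContinuousAt g 0) (hh : 0 < h)
    (hε : 0 < ε) (e : ∀ᶠ t in 𝓝[≠] (0 : ℂ), f t⁻¹ = t * h + t ^ 2 * a + t ^ 3 * g t) :
    ¬ ∃ w, ∀ z : ℂ, -ε < z.re → f z = w := by
  rintro ⟨w, hw⟩
  have hl : Tendsto (fun s : ℝ => (s : ℂ)) (𝓝[>] 0) (𝓝[≠] 0) := by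
    refine tendsto_nhdsWithin_iff.2 ⟨?_, ?_⟩
    · exact (Complex.continuous_ofReal.tendsto' 0 0 (by simp)).mono_left nhdsWithin_le_nhds
    · filter_upwards [self_mem_nhdsWithin] with s hs
      exact Complex.ofReal_ne_zero.2 (ne_of_gt hs)
  have hconst : ∀ᶠ t in map (fun s : ℝ => (s : ℂ)) (𝓝[>] 0), f t⁻¹ = w := by
    rw [eventually_map]
    filter_upwards [self_mem_nhdsWithin] with s hs
    have hs : 0 < s := hs
    apply hw
    rw [← Complex.ofReal_inv, Complex.ofReal_re]
    have := inv_pos.2 hs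
    linarith
  have e' := hl e
  have hw0 : w = 0 := by
    have h1 : ContinuousAt (fun t : ℂ => t * h + t ^ 2 * a + t ^ 3 * g t) 0 := by fun_prop
    have h2 := h1.tendsto.mono_left (hl.trans nhdsWithin_le_nhds)
    refine tendsto_nhds_unique_of_eventuallyEq (tendsto_const_nhds (x := w)) (by simpa using h2) ?_
    filter_upwards [hconst, e'] with t h1 h2
    exact Eq.trans (Eq.symm h1) h2
  have h3 := (expansion_coeff_unique (f := fun _ => 0) (g' := fun _ => 0) (h' := 0) (a' := 0)
    hg (by fun_prop) hl (by
      filter_upwards [hconst, e'] with t h1 h2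
      rw [← h2, h1, hw0]) (by simp)).1
  exact hh.ne' (by exact_mod_cast h3)

/-- What the existence of a Lyapunov pair needs: the conditions on a real triple `(A, B, c)` that
follow from strict positive realness of its transfer matrix. -/
structure IsStrictlyPassive {m n : ℕ} (A : Matrix (Fin n) (Fin n) ℝ)
    (B c : Matrix (Fin n) (Fin m) ℝ) : Prop where
  hurwitz : IsHurwitz A
  highFreq : ∃ h : Fin m → ℝ, (∀ i, 0 < h i) ∧ cᵀ * B = Matrix.diagonal h
  highFreq_second : ∀ v : Fin m → ℂ, v ≠ 0 → (star v ⬝ᵥ toC (cᵀ * A * B) *ᵥ v).re < 0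
  frequency : ∀ (ω : ℝ) (x : Fin n → ℂ) (v : Fin m → ℂ), v ≠ 0 →
    toC A *ᵥ x + toC B *ᵥ v = (ω * Complex.I) • x → 0 < (star v ⬝ᵥ (toC c)ᵀ *ᵥ x).re

theorem re_star_dotProduct_diagonal {m : ℕ} (d v : Fin m → ℂ) :
    (star v ⬝ᵥ Matrix.diagonal d *ᵥ v).re = ∑ i, Complex.normSq (v i) * (d i).re := by
  simp only [dotProduct, Matrix.mulVec_diagonal, Complex.re_sum, Pi.star_apply]
  refine Finset.sum_congr rfl fun i _ => ?_
  have : star (v i) * (d i * v i) = (Complex.normSq (v i) : ℂ) * d i := by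
    rw [← Complex.mul_conj, starRingEnd_apply]; ring
  rw [this, Complex.re_ofReal_mul]

theorem re_star_dotProduct_diagonal_pos {m : ℕ} {d v : Fin m → ℂ} (hd : ∀ i, 0 < (d i).re)
    (hv : v ≠ 0) : 0 < (star v ⬝ᵥ Matrix.diagonal d *ᵥ v).re := by
  rw [re_star_dotProduct_diagonal]
  obtain ⟨i, hi⟩ := Function.ne_iff.1 hv
  refine Finset.sum_pos' (fun j _ => mul_nonneg (Complex.normSq_nonneg _) (hd j).le)
    ⟨i, Finset.mem_univ i, mul_pos (Complex.normSq_pos.2 hi) (hd i)⟩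

/-- W is diagonal, hence so are both Markov parameters; their diagonal signs come from the expansion
at infinity. For the frequency condition, x = (iω - A)⁻¹Bv, so v*cᵀx = v*W(iω)v. -/
theorem isStrictlyPassive_of_isSPR {m n : ℕ} {J b φ p q θ k : Fin m → ℝ} (hJ : ∀ i, 0 < J i)
    (hφ : ∀ i, 0 < φ i) (hspr : IsSPR (shapedTransfer J b φ p q θ k))
    {A : Matrix (Fin n) (Fin n) ℝ} {B c : Matrix (Fin n) (Fin m) ℝ}
    (hreal : IsStableRealization (shapedTransfer J b φ p q θ k) A B c) :
    IsStrictlyPassive A B c := by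
  obtain ⟨hA, htr⟩ := hreal
  rw [shapedTransfer_eq hJ] at hspr htr
  set d : Fin m → RatFunc ℝ := fun i => channel (J i) (b i) (φ i) (p i) (q i) (θ i) (k i) with hd
  obtain ⟨ε, hε, hpr⟩ := (isSPR_diagonal_iff d).1 hspr
  have hexp := evalAt_realization_expansion htr
  have hoff : ∀ i j, i ≠ j → (cᵀ * B) i j = 0 ∧ (cᵀ * A * B) i j = 0 := by
    intro i j hij
    obtain ⟨g, hg, e⟩ := hexp i j
    simp only [evalAt_diagonal, Matrix.diagonal_apply_ne _ hij] at e
    have := expansion_coeff_unique (f := fun _ => 0) (g' := fun _ => 0) (h' := 0) (a' := 0)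
      hg (by fun_prop) le_rfl e (by simp)
    exact_mod_cast this
  have hdiag : ∀ i, (cᵀ * B) i i = φ i / J i ∧ (cᵀ * A * B) i i < 0 ∧
      ∀ z : ℂ, -ε < z.re → 0 < (RatFunc.eval (algebraMap ℝ ℂ) z (d i)).re := by
    intro i
    obtain ⟨g, hg, e⟩ := hexp i i
    simp only [evalAt_diagonal, Matrix.diagonal_apply_eq] at e
    have h1 : (cᵀ * B) i i = φ i / J i := by
      have hc : ContinuousAt (fun t : ℂ => (((cᵀ * B) i i : ℝ) : ℂ)
        + t * ((cᵀ * A * B) i i : ℝ) + t ^ 2 * g t) 0 := by fun_prop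
      have hc' := hc.tendsto.mono_left (nhdsWithin_le_nhds (s := {0}ᶜ))
      have := tendsto_nhds_unique_of_eventuallyEq hc'
        (tendsto_channel_div (hJ i) (b i) (φ i) (p i) (q i) (θ i) (k i)) (by
          filter_upwards [e, self_mem_nhdsWithin] with t h1 h2
          have h2 : t ≠ 0 := h2
          rw [eq_div_iff h2]
          change _ = RatFunc.eval (algebraMap ℝ ℂ) t⁻¹ (d i)
          rw [h1]
          ring)
      simp only [zero_mul, add_zero, ne_eq, OfNat.ofNat_ne_zero, not_false_eq_true, zero_pow] at this
      exact_mod_cast this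
    have h2 : 0 < (cᵀ * B) i i := by rw [h1]; exact div_pos (hφ i) (hJ i)
    refine ⟨h1, ?_, fun z hz => ?_⟩
    · exact second_coeff_neg (f := fun z => RatFunc.eval (algebraMap ℝ ℂ) z (d i)) hg h2 hε e
        (hpr i).2
    · exact re_pos_of_re_nonneg (hpr i).1 (hpr i).2 (not_const_of_expansion
        (f := fun z => RatFunc.eval (algebraMap ℝ ℂ) z (d i)) hg h2 hε e) hz
  refine ⟨hA, ⟨fun i => φ i / J i, fun i => div_pos (hφ i) (hJ i), ?_⟩, fun v hv => ?_,
    fun ω x v hv hx => ?_⟩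
  · ext i j
    by_cases hij : i = j
    · subst hij; rw [(hdiag i).1, Matrix.diagonal_apply_eq]
    · rw [(hoff i j hij).1, Matrix.diagonal_apply_ne _ hij]
  · have h1 : toC (cᵀ * A * B) = -Matrix.diagonal fun i => ((-(cᵀ * A * B) i i : ℝ) : ℂ) := by
      ext i j
      by_cases hij : i = j
      · subst hij; simp
      · rw [toC, Matrix.map_apply, (hoff i j hij).2, Matrix.neg_apply,
          Matrix.diagonal_apply_ne _ hij]
        simp
    rw [h1, Matrix.neg_mulVec, dotProduct_neg, Complex.neg_re, neg_lt_zero]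
    exact re_star_dotProduct_diagonal_pos (fun i => by simpa using (hdiag i).2.1) hv
  · have hre : (ω * Complex.I).re = 0 := by simp
    have hdet := hA.det_ne_zero (z := ω * Complex.I) hre.ge
    have h1 : ((ω * Complex.I) • 1 - toC A) *ᵥ x = toC B *ᵥ v := by
      rw [Matrix.sub_mulVec, Matrix.smul_mulVec, Matrix.one_mulVec, ← hx, add_sub_cancel_left]
    have h2 : x = ((ω * Complex.I) • 1 - toC A)⁻¹ *ᵥ toC B *ᵥ v := by
      rw [← h1, Matrix.mulVec_mulVec, Matrix.nonsing_inv_mul _ (isUnit_iff_ne_zero.2 hdet),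
        Matrix.one_mulVec]
    have h3 := evalAt_realization htr hdet
    rw [evalAt_diagonal] at h3
    rw [h2, Matrix.mulVec_mulVec, Matrix.mulVec_mulVec, ← h3]
    exact re_star_dotProduct_diagonal_pos (fun i => (hdiag i).2.2 _ (by rw [hre]; linarith)) hv

/-! ### Simultaneous reduction of a skew pencil -/

open InnerProductSpace in
/-- If `f g†` is skew-adjoint, then the domain has an orthonormal basis each of whose members `w`
satisfies `f w = i ω g w` for a real `ω`, or `g w = 0`. -/
theorem exists_orthonormalBasis_of_skew {E V : Type*} [NormedAddCommGroup E]
    [InnerProductSpace ℂ E] [FiniteDimensional ℂ E] [NormedAddCommGroup V] [InnerProductSpace ℂ V]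
    [FiniteDimensional ℂ V] {N : ℕ} (hN : Module.finrank ℂ E = N) (f g : E →ₗ[ℂ] V)
    (hfg : f ∘ₗ LinearMap.adjoint g + g ∘ₗ LinearMap.adjoint f = 0) :
    ∃ w : OrthonormalBasis (Fin N) ℂ E, ∀ k,
      (∃ ω : ℝ, f (w k) = (ω * Complex.I) • g (w k)) ∨ g (w k) = 0 := by
  -- K is the orthogonal complement of ker g; below, P projects onto K, and h is a section of g†
  -- over K, so g†h = P.
  set K : Submodule ℂ E := LinearMap.range (LinearMap.adjoint g)
  obtain ⟨r, hr⟩ := LinearMap.exists_rightInverse_of_surjective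
    (LinearMap.adjoint g).rangeRestrict (LinearMap.range_rangeRestrict _)
  let P : E →ₗ[ℂ] E := K.starProjection
  let h : E →ₗ[ℂ] V := r ∘ₗ (K.orthogonalProjectionOnto : E →ₗ[ℂ] K)
  have hPsymm : ∀ u v, ⟪P u, v⟫_ℂ = ⟪u, P v⟫_ℂ := K.starProjection_isSymmetric
  have hPP : ∀ u, P (P u) = P u := fun u =>
    K.starProjection_eq_self_iff.2 (K.starProjection_apply_mem u)
  have hgh : ∀ u, LinearMap.adjoint g (h u) = P u := by
    intro u
    have := LinearMap.congr_fun hr (K.orthogonalProjectionOnto u)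
    exact congrArg Subtype.val this
  have hhP : ∀ u, h (P u) = h u := by
    intro u
    have : K.orthogonalProjectionOnto (P u) = K.orthogonalProjectionOnto u :=
      Subtype.ext (hPP u)
    simp only [h, LinearMap.comp_apply]
    exact congrArg r this
  have hgP : ∀ u, g (P u) = g u := by
    intro u
    apply ext_inner_right ℂ
    intro a
    rw [← LinearMap.adjoint_inner_right g (P u) a, ← LinearMap.adjoint_inner_right g u a, hPsymm]
    congr 1
    exact K.starProjection_eq_self_iff.2 ⟨a, rfl⟩
  have hfg' : ∀ a, f (LinearMap.adjoint g a) = -g (LinearMap.adjoint f a) := fun a =>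
    eq_neg_of_add_eq_zero_left (LinearMap.congr_fun hfg a)
  have hskew : ∀ a b, ⟪LinearMap.adjoint f a, LinearMap.adjoint g b⟫_ℂ
      = -⟪LinearMap.adjoint g a, LinearMap.adjoint f b⟫_ℂ := by
    intro a b
    rw [LinearMap.adjoint_inner_left, hfg', inner_neg_right, ← LinearMap.adjoint_inner_left]
  -- Formally f = g·(iS) on K; skewness of f g† is what makes S Hermitian.
  let S : E →ₗ[ℂ] E := Complex.I • (P ∘ₗ LinearMap.adjoint f ∘ₗ h)
  have hS : ∀ u, S u = Complex.I • P (LinearMap.adjoint f (h u)) := fun u => rfl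
  have hSP : ∀ u, S (P u) = S u := fun u => by rw [hS, hS, hhP]
  have hPS : ∀ u, P (S u) = S u := fun u => by rw [hS, map_smul, hPP]
  have hSsymm : ∀ u v, ⟪S u, v⟫_ℂ = ⟪u, S v⟫_ℂ := by
    intro u v
    rw [hS, hS, inner_smul_left, inner_smul_right, hPsymm, ← hPsymm u, ← hgh v, ← hgh u,
      hskew]
    simp
  -- S vanishes on the complement of K. Giving that complement an eigenvalue τ > ‖S‖ prevents
  -- eigenvectors of T from mixing the two parts: each lies in K or in ker g.
  let τ : ℝ := ‖LinearMap.toContinuousLinearMap S‖ + 1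
  let T : E →ₗ[ℂ] E := S + (τ : ℂ) • (LinearMap.id - P)
  have hT : T.IsSymmetric := by
    intro u v
    simp only [T, LinearMap.add_apply, LinearMap.smul_apply, LinearMap.sub_apply,
      LinearMap.id_apply, inner_add_left, inner_add_right, inner_smul_left, inner_smul_right,
      inner_sub_left, inner_sub_right, hSsymm, hPsymm, Complex.conj_ofReal]
  refine ⟨hT.eigenvectorBasis hN, fun k => ?_⟩
  have hw := hT.apply_eigenvectorBasis hN k
  set w := hT.eigenvectorBasis hN k
  set μ := hT.eigenvalues hN k
  have hw' : S w + (τ : ℂ) • (w - P w) = (μ : ℂ) • w := hw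
  have hw1 : S w = (μ : ℂ) • P w := by
    have := congrArg P hw'
    simpa [hPS, hPP] using this
  by_cases hμ : μ = τ
  · right
    have h1 : ‖S (P w)‖ ≤ ‖LinearMap.toContinuousLinearMap S‖ * ‖P w‖ :=
      (LinearMap.toContinuousLinearMap S).le_opNorm (P w)
    rw [hSP, hw1, norm_smul, hμ, Complex.norm_real, Real.norm_of_nonneg (by positivity)] at h1
    have h2 : ‖P w‖ = 0 := by
      have := norm_nonneg (P w)
      simp only [τ] at h1
      nlinarith
    rw [← hgP, norm_eq_zero.1 h2, map_zero]
  · left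
    have h1 : P w = w := by
      rw [hw1] at hw'
      have h2 : ((τ : ℂ) - μ) • (w - P w) = 0 := by
        rw [sub_smul, sub_eq_zero, smul_sub (μ : ℂ), ← hw']; abel
      rcases smul_eq_zero.1 h2 with h3 | h3
      · exact absurd (by exact_mod_cast (sub_eq_zero.1 h3).symm) hμ
      · exact (sub_eq_zero.1 h3).symm
    refine ⟨μ, ?_⟩
    have h3 : f w = -g (P (LinearMap.adjoint f (h w))) := by
      rw [hgP, ← hfg', hgh, h1]
    have h4 : P (LinearMap.adjoint f (h w)) = -Complex.I • S w := by
      rw [hS, smul_smul]; simp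
    rw [h3, h4, hw1, h1, smul_smul, map_smul, ← neg_smul]
    congr 1
    ring

/-! ### Existence of a storage matrix -/

open scoped MatrixOrder in
theorem exists_isSymm_mul_self {n : ℕ} {Z : Matrix (Fin n) (Fin n) ℝ} (hZ : Z.PosSemidef) :
    ∃ X : Matrix (Fin n) (Fin n) ℝ, Xᵀ = X ∧ X * X = Z := by
  obtain ⟨X, hX, -, h⟩ := CFC.exists_sqrt_of_isSelfAdjoint_of_quasispectrumRestricts hZ.isHermitian
    (QuasispectrumRestricts.nnreal_of_nonneg hZ.nonneg)
  refine ⟨X, ?_, h⟩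
  have := hX.star_eq
  rwa [Matrix.star_eq_conjTranspose, Matrix.conjTranspose_eq_transpose_of_trivial] at this

/-- The real matrices whose quadratic form is negative definite. -/
def negForms (n : ℕ) : Set (Matrix (Fin n) (Fin n) ℝ) :=
  {N | ∀ x : Fin n → ℝ, x ≠ 0 → x ⬝ᵥ N *ᵥ x < 0}

theorem convex_negForms (n : ℕ) : Convex ℝ (negForms n) := by
  refine convex_iff_forall_pos.2 fun M hM N hN a b ha hb _ x hx => ?_
  rw [Matrix.add_mulVec, Matrix.smul_mulVec, Matrix.smul_mulVec, dotProduct_add, dotProduct_smul,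
    dotProduct_smul, smul_eq_mul, smul_eq_mul]
  nlinarith [mul_pos ha (neg_pos.2 (hM x hx)), mul_pos hb (neg_pos.2 (hN x hx))]

theorem isOpen_negForms (n : ℕ) : IsOpen (negForms n) := by
  have h1 : negForms n = {N | ∀ x ∈ Metric.sphere (0 : Fin n → ℝ) 1, x ⬝ᵥ N *ᵥ x < 0} := by
    ext N
    refine ⟨fun h x hx => h x (ne_zero_of_mem_unit_sphere ⟨x, hx⟩), fun h x hx => ?_⟩
    have hx' : 0 < ‖x‖ := norm_pos_iff.2 hx
    have h2 := h (‖x‖⁻¹ • x) (by simp [norm_smul, hx'.ne'])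
    rw [Matrix.mulVec_smul, dotProduct_smul, smul_dotProduct, smul_eq_mul, smul_eq_mul,
      ← mul_assoc] at h2
    have h3 : 0 < ‖x‖⁻¹ * ‖x‖⁻¹ := by positivity
    by_contra h4
    exact absurd h2 (not_lt.2 (mul_nonneg h3.le (not_lt.1 h4)))
  rw [h1, isOpen_iff_eventually]
  intro N hN
  refine (isCompact_sphere (0 : Fin n → ℝ) 1).eventually_forall_of_forall_eventually fun x hx => ?_
  have hc : Continuous fun z : Matrix (Fin n) (Fin n) ℝ × (Fin n → ℝ) => z.2 ⬝ᵥ z.1 *ᵥ z.2 := by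
    fun_prop
  exact (isOpen_lt hc continuous_const).mem_nhds (hN x hx)

theorem eq_zero_of_forall_add_mul_lt {a b u : ℝ} (h : ∀ t : ℝ, a + t * b < u) : b = 0 := by
  by_contra hb
  have := h ((u - a) / b)
  rw [div_mul_cancel₀ _ hb] at this
  linarith

/-- A linear functional bounded above on the negative definite forms is the trace pairing with a
positive semidefinite matrix. -/
theorem exists_posSemidef_of_bounded_on_negForms {n : ℕ}
    (f : Matrix (Fin n) (Fin n) ℝ →ₗ[ℝ] ℝ) {u : ℝ} (hf : ∀ N ∈ negForms n, f N < u) :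
    0 ≤ u ∧ ∃ Z : Matrix (Fin n) (Fin n) ℝ, Z.PosSemidef ∧ ∀ N, f N = (N * Z).trace := by
  have hself : ∀ x : Fin n → ℝ, x ≠ 0 → 0 < x ⬝ᵥ x := fun x hx =>
    lt_of_le_of_ne (Finset.sum_nonneg fun i _ => mul_self_nonneg (x i)) (fun h => hx (dotProduct_self_eq_zero.1 h.symm))
  -- All negative multiples of the identity are negative definite, and f takes values arbitrarily
  -- near 0 on them.
  have hu : 0 ≤ u := by
    by_contra hu
    push Not at hu
    have h1 : ∀ s : ℝ, 0 < s → -s * f 1 < u := by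
      intro s hs
      have := hf (-s • 1) (fun x hx => by
        rw [Matrix.smul_mulVec, Matrix.one_mulVec, dotProduct_smul, smul_eq_mul]
        nlinarith [hself x hx])
      simpa using this
    by_cases h0 : f 1 ≤ 0
    · have := h1 1 one_pos
      linarith
    · push Not at h0
      have h2 := h1 (-u / f 1) (div_pos (by linarith) h0)
      rw [neg_mul, div_mul_cancel₀ _ h0.ne'] at h2
      linarith
  refine ⟨hu, Matrix.of fun j i => f (Matrix.single i j 1), ?_, fun N => ?_⟩
  swap
  · conv_lhs => rw [Matrix.matrix_eq_sum_single N]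
    simp only [map_sum, Matrix.trace, Matrix.diag_apply, Matrix.mul_apply, Matrix.of_apply]
    refine Finset.sum_congr rfl fun i _ => Finset.sum_congr rfl fun j _ => ?_
    have : Matrix.single i j (N i j) = N i j • Matrix.single i j (1 : ℝ) := by
      rw [Matrix.smul_single, smul_eq_mul, mul_one]
    rw [this, map_smul, smul_eq_mul]
  set Z : Matrix (Fin n) (Fin n) ℝ := Matrix.of fun j i => f (Matrix.single i j 1) with hZ
  -- A skew matrix has zero quadratic form, so -1 + tK stays negative definite for every real t;
  -- boundedness of f along this line forces f K = 0. Symmetry of Z follows.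
  have hskew : ∀ K : Matrix (Fin n) (Fin n) ℝ, Kᵀ = -K → f K = 0 := by
    intro K hK
    have hq : ∀ x, x ⬝ᵥ K *ᵥ x = 0 := by
      intro x
      have h1 : x ⬝ᵥ K *ᵥ x = -(x ⬝ᵥ K *ᵥ x) := by
        conv_lhs => rw [Matrix.dotProduct_mulVec, ← Matrix.mulVec_transpose, hK, Matrix.neg_mulVec, neg_dotProduct, dotProduct_comm]
      linarith
    refine eq_zero_of_forall_add_mul_lt (a := f (-1)) (u := u) fun t => ?_
    have := hf (-1 + t • K) (fun x hx => by
      rw [Matrix.add_mulVec, Matrix.smul_mulVec, dotProduct_add, dotProduct_smul, hq,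
        Matrix.neg_mulVec, Matrix.one_mulVec, dotProduct_neg, smul_zero, add_zero]
      linarith [hself x hx])
    rwa [map_add, map_smul, smul_eq_mul] at this
  refine Matrix.PosSemidef.of_dotProduct_mulVec_nonneg ?_ fun x => ?_
  · rw [Matrix.IsHermitian, Matrix.conjTranspose_eq_transpose_of_trivial]
    ext i j
    have := hskew (Matrix.single i j 1 - Matrix.single j i 1) (by
      rw [Matrix.transpose_sub, Matrix.transpose_single, Matrix.transpose_single, neg_sub])
    rw [map_sub] at this
    simp only [hZ, Matrix.transpose_apply, Matrix.of_apply]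
    linarith
  · have hx : star x ⬝ᵥ Z *ᵥ x = f (Matrix.vecMulVec x x) := by
      conv_rhs => rw [Matrix.matrix_eq_sum_single (Matrix.vecMulVec x x)]
      simp only [map_sum, dotProduct, Matrix.mulVec, Finset.mul_sum, star_trivial]
      rw [Finset.sum_comm]
      refine Finset.sum_congr rfl fun i _ => Finset.sum_congr rfl fun j _ => ?_
      have : Matrix.single i j (Matrix.vecMulVec x x i j)
          = (x i * x j) • Matrix.single i j (1 : ℝ) := by
        rw [Matrix.smul_single, smul_eq_mul, mul_one, Matrix.vecMulVec_apply]
      rw [this, map_smul, smul_eq_mul, hZ, Matrix.of_apply]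
      ring
    rw [hx]
    by_contra hneg
    push Not at hneg
    -- Along the ray -1 - s xxᵀ of negative definite matrices a negative f(xxᵀ) would make f
    -- unbounded above.
    have h1 : ∀ s : ℝ, 0 ≤ s → f (-1) - s * f (Matrix.vecMulVec x x) < u := by
      intro s hs
      have := hf (-1 - s • Matrix.vecMulVec x x) (fun y hy => by
        rw [Matrix.sub_mulVec, Matrix.smul_mulVec, dotProduct_sub, dotProduct_smul,
          Matrix.neg_mulVec, Matrix.one_mulVec, dotProduct_neg, smul_eq_mul,
          Matrix.vecMulVec_mulVec, dotProduct_smul]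
        have h2 := mul_nonneg hs (mul_self_nonneg (x ⬝ᵥ y))
        rw [op_smul_eq_smul, smul_eq_mul, dotProduct_comm y x]
        linarith [hself y hy])
      rwa [map_sub, map_smul, smul_eq_mul] at this
    have h2 := h1 ((|u - f (-1)|) / -f (Matrix.vecMulVec x x))
      (div_nonneg (abs_nonneg _) (by linarith))
    rw [div_neg, neg_mul, div_mul_cancel₀ _ hneg.ne] at h2
    linarith [le_abs_self (u - f (-1))]

theorem toC_mul {a b d : ℕ} (M : Matrix (Fin a) (Fin b) ℝ) (N : Matrix (Fin b) (Fin d) ℝ) :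
    toC (M * N) = toC M * toC N :=
  Matrix.map_mul

theorem toC_conjTranspose {a b : ℕ} (M : Matrix (Fin a) (Fin b) ℝ) : (toC M)ᴴ = toC Mᵀ := by
  ext i j; simp

theorem star_dotProduct_toC_mulVec {a b : ℕ} (M : Matrix (Fin a) (Fin b) ℝ) (x : Fin a → ℂ)
    (y : Fin b → ℂ) : star x ⬝ᵥ toC M *ᵥ y = star (star y ⬝ᵥ toC Mᵀ *ᵥ x) := by
  rw [← toC_conjTranspose, ← star_star (star x ⬝ᵥ toC M *ᵥ y)]
  congr 1
  rw [star_dotProduct, star_star, Matrix.star_mulVec, ← Matrix.dotProduct_mulVec]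

/-- The sign of the storage rate of a modal direction of the separating matrix. -/
theorem IsStrictlyPassive.re_neg_of_mode {m n : ℕ} {A : Matrix (Fin n) (Fin n) ℝ}
    {B c : Matrix (Fin n) (Fin m) ℝ} (h : IsStrictlyPassive A B c)
    {P : Matrix (Fin n) (Fin n) ℝ} (hP : Pᵀ = P) (hPB : P * B = c)
    {G : Matrix (Fin m) (Fin n) ℝ} {x : Fin n → ℂ} (hx : x ≠ 0)
    (hmode : (∃ ω : ℝ, toC ((1 - B * G) * A) *ᵥ x = (ω * Complex.I) • toC (1 - B * G) *ᵥ x) ∨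
      toC (1 - B * G) *ᵥ x = 0) :
    (star x ⬝ᵥ toC (P * A) *ᵥ x).re < 0 := by
  have hcB : ∀ v : Fin m → ℂ, toC P *ᵥ toC B *ᵥ v = toC c *ᵥ v := fun v => by
    rw [Matrix.mulVec_mulVec, ← toC_mul, hPB]
  have hproj : ∀ y : Fin n → ℂ, toC (1 - B * G) *ᵥ y = y - toC B *ᵥ (toC G *ᵥ y) := by
    intro y
    have : toC (1 - B * G) = 1 - toC B * toC G := by
      rw [← toC_mul, toC, Matrix.map_sub _ (fun a b => map_sub (algebraMap ℝ ℂ) a b),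
        Matrix.map_one _ (map_zero _) (map_one _)]
    rw [this, Matrix.sub_mulVec, Matrix.one_mulVec, Matrix.mulVec_mulVec]
  rcases hmode with ⟨ω, hω⟩ | h0
  · rw [toC_mul, ← Matrix.mulVec_mulVec, hproj, hproj, smul_sub] at hω
    -- The mode equation says that iωx - Ax equals Bv for this v, and v ≠ 0 because A has no
    -- imaginary eigenvalue. As x*Px is real, Re x*PAx = -Re x*PBv = -Re v*cᵀx.
    set v : Fin m → ℂ := (ω * Complex.I) • (toC G *ᵥ x) - toC G *ᵥ (toC A *ᵥ x) with hv
    have hAx : toC A *ᵥ x + toC B *ᵥ v = (ω * Complex.I) • x := by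
      rw [hv, Matrix.mulVec_sub, Matrix.mulVec_smul]
      linear_combination (exp := 1) hω
    have hv0 : v ≠ 0 := by
      intro hv0
      rw [hv0, Matrix.mulVec_zero, add_zero] at hAx
      exact hx (h.hurwitz.eq_zero_of_mulVec (by simp) hAx)
    have hpos := h.frequency ω x v hv0 hAx
    have hAx' : toC A *ᵥ x = (ω * Complex.I) • x - toC B *ᵥ v := by rw [← hAx]; abel
    rw [toC_mul, ← Matrix.mulVec_mulVec, hAx', Matrix.mulVec_sub, Matrix.mulVec_smul, hcB,
      dotProduct_sub, dotProduct_smul, Complex.sub_re, smul_eq_mul]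
    have h1 : (star x ⬝ᵥ toC P *ᵥ x).im = 0 := by
      have h2 := congrArg Complex.im (star_dotProduct_toC_mulVec P x x)
      rw [hP, Complex.star_def, Complex.conj_im] at h2
      linarith
    have h3 : (star x ⬝ᵥ toC c *ᵥ v).re = (star v ⬝ᵥ (toC c)ᵀ *ᵥ x).re := by
      rw [star_dotProduct_toC_mulVec, Complex.star_def, Complex.conj_re]
      rfl
    rw [h3]
    simp [h1]
    exact hpos
  · rw [hproj, sub_eq_zero] at h0
    -- Here x = Bv, so x*PAx = v*BᵀPABv = v*cᵀABv.
    set v := toC G *ᵥ x with hv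
    have hv0 : v ≠ 0 := by
      intro hv0
      rw [hv0, Matrix.mulVec_zero] at h0
      exact hx h0
    have h1 := h.highFreq_second v hv0
    have h2 : star x ⬝ᵥ toC (P * A) *ᵥ x = star v ⬝ᵥ toC (cᵀ * A * B) *ᵥ v := by
      conv_lhs => rw [h0]
      rw [Matrix.star_mulVec, ← Matrix.dotProduct_mulVec, toC_conjTranspose, Matrix.mulVec_mulVec,
        Matrix.mulVec_mulVec, ← toC_mul, ← toC_mul, ← hPB, Matrix.transpose_mul, hP]
      simp only [Matrix.mul_assoc]
    rwa [h2]

theorem re_trace_eq_sum {n : ℕ} (M : Matrix (Fin n) (Fin n) ℂ)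
    (w : OrthonormalBasis (Fin n) ℂ (EuclideanSpace ℂ (Fin n))) :
    M.trace = ∑ k, star (⇑(w k)) ⬝ᵥ M *ᵥ ⇑(w k) := by
  have h1 := LinearMap.trace_eq_sum_inner (Matrix.toEuclideanLin M) w
  have h2 : LinearMap.trace ℂ (EuclideanSpace ℂ (Fin n)) (Matrix.toEuclideanLin M) = M.trace := by
    rw [Matrix.toEuclideanLin_eq_toLin_orthonormal, Matrix.trace_toLin_eq]
  rw [← h2, h1]
  refine Finset.sum_congr rfl fun k _ => ?_
  rw [EuclideanSpace.inner_eq_star_dotProduct, dotProduct_comm]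
  rfl

/-- The separating matrix of an infeasible storage problem vanishes. -/
theorem IsStrictlyPassive.eq_zero_of_skew {m n : ℕ} {A : Matrix (Fin n) (Fin n) ℝ}
    {B c : Matrix (Fin n) (Fin m) ℝ} (h : IsStrictlyPassive A B c)
    {P : Matrix (Fin n) (Fin n) ℝ} (hP : Pᵀ = P) (hPB : P * B = c)
    {G : Matrix (Fin m) (Fin n) ℝ} {Z : Matrix (Fin n) (Fin n) ℝ} (hZ : Z.PosSemidef)
    (hskew : ((1 - B * G) * A * Z * (1 - B * G)ᵀ) + ((1 - B * G) * A * Z * (1 - B * G)ᵀ)ᵀ = 0)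
    (htr : 0 ≤ (P * A * Z).trace) : Z = 0 := by
  obtain ⟨X, hX, hXX⟩ := exists_isSymm_mul_self hZ
  set Q := 1 - B * G with hQ
  have hadj : ∀ M : Matrix (Fin n) (Fin n) ℝ,
      LinearMap.adjoint (Matrix.toEuclideanLin (toC M)) = Matrix.toEuclideanLin (toC Mᵀ) := by
    intro M
    rw [← Matrix.toEuclideanLin_conjTranspose_eq_adjoint, toC_conjTranspose]
  have hcomp : ∀ M N : Matrix (Fin n) (Fin n) ℂ, Matrix.toEuclideanLin M ∘ₗ Matrix.toEuclideanLin N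
      = Matrix.toEuclideanLin (M * N) := by
    intro M N
    ext x i
    simp [Matrix.toEuclideanLin, Matrix.mulVec_mulVec]
  obtain ⟨w, hw⟩ := exists_orthonormalBasis_of_skew finrank_euclideanSpace_fin
    (Matrix.toEuclideanLin (toC (Q * A * X))) (Matrix.toEuclideanLin (toC (Q * X))) (by
      rw [hadj, hadj, hcomp, hcomp, ← toC_mul, ← toC_mul, ← map_add]
      have h1 : Q * A * X * (Q * X)ᵀ = Q * A * Z * Qᵀ := by
        rw [Matrix.transpose_mul, hX, ← hXX]; simp only [Matrix.mul_assoc]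
      have h2 : Q * X * (Q * A * X)ᵀ = (Q * A * Z * Qᵀ)ᵀ := by
        rw [← h1, Matrix.transpose_mul (Q * A * X), Matrix.transpose_transpose]
      rw [h1, h2]
      have h3 : toC (Q * A * Z * Qᵀ) + toC (Q * A * Z * Qᵀ)ᵀ = 0 := by
        rw [toC, toC, ← Matrix.map_add _ (fun a b => map_add (algebraMap ℝ ℂ) a b), hskew,
          Matrix.map_zero _ (map_zero _)]
      rw [h3, map_zero])
  set x : Fin n → Fin n → ℂ := fun k => toC X *ᵥ ⇑(w k) with hx
  have hmode : ∀ k, (∃ ω : ℝ, toC (Q * A) *ᵥ x k = (ω * Complex.I) • toC Q *ᵥ x k) ∨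
      toC Q *ᵥ x k = 0 := by
    intro k
    simp only [hx, Matrix.mulVec_mulVec, ← toC_mul]
    rcases hw k with ⟨ω, hω⟩ | h0
    · exact Or.inl ⟨ω, congrArg WithLp.ofLp hω⟩
    · exact Or.inr (congrArg WithLp.ofLp h0)
  have hneg : ∀ k, x k ≠ 0 → (star (x k) ⬝ᵥ toC (P * A) *ᵥ x k).re < 0 := fun k hk =>
    h.re_neg_of_mode hP hPB hk (hmode k)
  -- With Z = X², tr(PAZ) = tr(X PA X), computed in the orthonormal basis w.
  have hsum : (P * A * Z).trace = ∑ k, (star (x k) ⬝ᵥ toC (P * A) *ᵥ x k).re := by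
    have h1 : (P * A * Z).trace = (X * (P * A) * X).trace := by
      rw [← hXX, ← Matrix.mul_assoc, Matrix.trace_mul_comm, ← Matrix.mul_assoc]
    have h2 := re_trace_eq_sum (toC (X * (P * A) * X)) w
    have h3 : (toC (X * (P * A) * X)).trace = (((X * (P * A) * X).trace : ℝ) : ℂ) := by
      rw [Matrix.trace, Matrix.trace, Complex.ofReal_sum]
      rfl
    rw [h1, ← Complex.ofReal_re (X * (P * A) * X).trace, ← h3, h2, Complex.re_sum]
    refine Finset.sum_congr rfl fun k _ => ?_
    rw [hx, Matrix.star_mulVec, ← Matrix.dotProduct_mulVec, toC_conjTranspose, hX,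
      Matrix.mulVec_mulVec, Matrix.mulVec_mulVec, ← toC_mul, ← toC_mul, Matrix.mul_assoc]
  have hzero : ∀ k, x k = 0 := by
    by_contra hne
    push Not at hne
    obtain ⟨k, hk⟩ := hne
    have : ∑ k, (star (x k) ⬝ᵥ toC (P * A) *ᵥ x k).re < 0 := by
      refine Finset.sum_neg' (fun j _ => ?_) ⟨k, Finset.mem_univ k, hneg k hk⟩
      by_cases hj : x j = 0
      · rw [hj]; simp
      · exact (hneg j hj).le
    linarith
  have hX0 : Matrix.toEuclideanLin (toC X) = 0 := by
    refine w.toBasis.ext fun k => ?_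
    rw [w.coe_toBasis, LinearMap.zero_apply]
    exact WithLp.ofLp_injective 2 (hzero k)
  have hX1 : toC X = 0 := by simpa using hX0
  have hX2 : X = 0 := by
    ext i j
    have := congrFun (congrFun hX1 i) j
    simpa using this
  rw [← hXX, hX2, Matrix.mul_zero]

theorem IsStrictlyPassive.exists_storage {m n : ℕ} {A : Matrix (Fin n) (Fin n) ℝ}
    {B c : Matrix (Fin n) (Fin m) ℝ} (h : IsStrictlyPassive A B c) :
    ∃ P : Matrix (Fin n) (Fin n) ℝ, Pᵀ = P ∧ P * B = c ∧ P * A ∈ negForms n := by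
  obtain ⟨d, hd, hcB⟩ := h.highFreq
  set H : Matrix (Fin m) (Fin m) ℝ := Matrix.diagonal fun i => (d i)⁻¹ with hH
  set G : Matrix (Fin m) (Fin n) ℝ := H * cᵀ with hG
  have hGB : G * B = 1 := by
    rw [hG, Matrix.mul_assoc, hcB, hH, Matrix.diagonal_mul_diagonal, ← Matrix.diagonal_one]
    congr 1
    funext i
    exact inv_mul_cancel₀ (hd i).ne'
  set P₀ : Matrix (Fin n) (Fin n) ℝ := c * G with hP₀
  have hP₀B : P₀ * B = c := by rw [hP₀, Matrix.mul_assoc, hGB, Matrix.mul_one]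
  have hP₀s : P₀ᵀ = P₀ := by
    rw [hP₀, hG, Matrix.transpose_mul, Matrix.transpose_mul, Matrix.transpose_transpose, hH,
      Matrix.diagonal_transpose, Matrix.mul_assoc]
  set Q : Matrix (Fin n) (Fin n) ℝ := 1 - B * G with hQ
  have hQB : Q * B = 0 := by
    rw [hQ, Matrix.sub_mul, Matrix.one_mul, Matrix.mul_assoc, hGB, Matrix.mul_one, sub_self]
  by_contra hno
  push Not at hno
  -- QB = 0, so each P₀ + QᵀRQ is again a symmetric solution of PB = c.
  let t : Set (Matrix (Fin n) (Fin n) ℝ) := {N | ∃ R, Rᵀ = R ∧ N = (P₀ + Qᵀ * R * Q) * A}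
  have ht : Convex ℝ t := by
    rintro _ ⟨R, hR, rfl⟩ _ ⟨R', hR', rfl⟩ a b _ _ hab
    refine ⟨a • R + b • R', ?_, ?_⟩
    · rw [Matrix.transpose_add, Matrix.transpose_smul, Matrix.transpose_smul, hR, hR']
    · have : P₀ = a • P₀ + b • P₀ := by rw [← add_smul, hab, one_smul]
      conv_rhs => rw [this]
      simp only [Matrix.add_mul, Matrix.mul_add, Matrix.smul_mul, Matrix.mul_smul, smul_add]
      abel
  have hdisj : Disjoint (negForms n) t := by
    rw [Set.disjoint_left]
    rintro _ hN ⟨R, hR, rfl⟩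
    refine hno _ ?_ ?_ hN
    · rw [Matrix.transpose_add, hP₀s, Matrix.transpose_mul, Matrix.transpose_mul, hR,
        Matrix.transpose_transpose, Matrix.mul_assoc]
    · rw [Matrix.add_mul, hP₀B, Matrix.mul_assoc, hQB, Matrix.mul_zero, add_zero]
  obtain ⟨f, u, hf, hu⟩ := geometric_hahn_banach_open (convex_negForms n) (isOpen_negForms n) ht hdisj
  obtain ⟨hu0, Z, hZ, hfZ⟩ := exists_posSemidef_of_bounded_on_negForms
    (f : Matrix (Fin n) (Fin n) ℝ →ₗ[ℝ] ℝ) (u := u) hf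
  have hfZ : ∀ N, f N = (N * Z).trace := hfZ
  -- The functional is bounded below on an affine space, hence constant in every direction R.
  have hslope : ∀ R : Matrix (Fin n) (Fin n) ℝ, Rᵀ = R → (R * (Q * A * Z * Qᵀ)).trace = 0 := by
    intro R hR
    have h1 : ∀ s : ℝ, u ≤ f (P₀ * A) + s * f (Qᵀ * R * Q * A) := by
      intro s
      have := hu _ ⟨s • R, by rw [Matrix.transpose_smul, hR], rfl⟩
      rwa [Matrix.add_mul, map_add, Matrix.mul_smul, Matrix.smul_mul, Matrix.smul_mul, map_smul,
        smul_eq_mul] at this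
    have h2 : -f (Qᵀ * R * Q * A) = 0 :=
      eq_zero_of_forall_add_mul_lt (a := -f (P₀ * A)) (u := -u + 1) fun s => by
        have := h1 s
        linarith
    rw [neg_eq_zero, hfZ] at h2
    rw [← h2, ← Matrix.mul_assoc R, Matrix.trace_mul_comm]
    simp only [Matrix.mul_assoc]
  have hskew : Q * A * Z * Qᵀ + (Q * A * Z * Qᵀ)ᵀ = 0 := by
    ext i j
    have := hslope (Matrix.single i j 1 + Matrix.single j i 1) (by
      rw [Matrix.transpose_add, Matrix.transpose_single, Matrix.transpose_single, add_comm])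
    rw [Matrix.add_mul, Matrix.trace_add, Matrix.trace_single_mul, Matrix.trace_single_mul] at this
    simp only [Matrix.add_apply, Matrix.transpose_apply, Matrix.zero_apply]
    simp only [smul_eq_mul, one_mul] at this
    linarith
  have htr : u ≤ (P₀ * A * Z).trace := by
    have := hu _ ⟨0, Matrix.transpose_zero, rfl⟩
    rwa [Matrix.mul_zero, Matrix.zero_mul, add_zero, hfZ] at this
  have hZ0 := h.eq_zero_of_skew hP₀s hP₀B hZ hskew (hu0.trans htr)
  -- Z = 0 makes the functional vanish, against f(-1) < u ≤ f(P₀A).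
  have h1 := hf (-1) (fun x hx => by
    rw [Matrix.neg_mulVec, Matrix.one_mulVec, dotProduct_neg, neg_lt_zero]
    exact lt_of_le_of_ne (Finset.sum_nonneg fun i _ => mul_self_nonneg (x i))
      (fun h => hx (dotProduct_self_eq_zero.1 h.symm)))
  rw [hfZ, hZ0, Matrix.mul_zero, Matrix.trace_zero] at h1
  rw [hZ0, Matrix.mul_zero, Matrix.trace_zero] at htr
  linarith

/-! ### Definiteness of the storage matrix -/

open scoped ENNReal NNReal in
-- By Gelfand's formula ‖a^k‖ is eventually at most r^k for some r < 1.
theorem tendsto_pow_zero_of_spectrum {R : Type*} [NormedRing R] [NormedAlgebra ℂ R]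
    [CompleteSpace R] [Nontrivial R] {a : R} (ha : ∀ z ∈ spectrum ℂ a, ‖z‖ < 1) :
    Tendsto (fun k : ℕ => a ^ k) atTop (𝓝 0) := by
  have hr : spectralRadius ℂ a < (1 : ℝ≥0) :=
    spectrum.spectralRadius_lt_of_forall_lt a fun z hz => by exact_mod_cast ha z hz
  obtain ⟨r, hr1, hr2⟩ := ENNReal.lt_iff_exists_nnreal_btwn.1 hr
  have hr2 : r < 1 := by exact_mod_cast hr2
  have hev := (spectrum.pow_nnnorm_pow_one_div_tendsto_nhds_spectralRadius a).eventually_lt_const hr1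
  rw [tendsto_zero_iff_norm_tendsto_zero]
  refine squeeze_zero' (Eventually.of_forall fun _ => norm_nonneg _) ?_
    (tendsto_pow_atTop_nhds_zero_of_lt_one r.2 hr2)
  filter_upwards [hev, eventually_gt_atTop 0] with k hk hk0
  have hk0' : (k : ℝ) ≠ 0 := by positivity
  have h1 : ((‖a ^ k‖₊ : ℝ≥0∞) ^ (1 / k : ℝ)) ^ (k : ℝ) ≤ (r : ℝ≥0∞) ^ (k : ℝ) :=
    ENNReal.rpow_le_rpow hk.le (by positivity)
  rw [← ENNReal.rpow_mul, one_div, inv_mul_cancel₀ hk0', ENNReal.rpow_one,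
    ENNReal.rpow_natCast] at h1
  exact_mod_cast h1

/-- An eigenvalue z of the Cayley transform corresponds to the eigenvalue (z-1)/(z+1) of A, whose
real part is nonnegative when |z| ≥ 1; z = -1 is excluded separately. -/
theorem cayley_norm_lt_one {n : ℕ} {A : Matrix (Fin n) (Fin n) ℝ} (hA : IsHurwitz A) {z : ℂ}
    {y : Fin n → ℂ} (hy : y ≠ 0) (h : y + toC A *ᵥ y = z • (y - toC A *ᵥ y)) : ‖z‖ < 1 := by
  by_contra hz
  push Not at hz
  have h1 : (z + 1) • toC A *ᵥ y = (z - 1) • y := by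
    rw [smul_sub] at h
    rw [add_smul, sub_smul, one_smul, one_smul]
    linear_combination (exp := 1) h
  by_cases hz1 : z + 1 = 0
  · rw [hz1, zero_smul, eq_comm, smul_eq_zero] at h1
    rcases h1 with h1 | h1
    · have : (2 : ℂ) = 0 := by linear_combination hz1 - h1
      norm_num at this
    · exact hy h1
  · refine hy (hA.eq_zero_of_mulVec (z := (z - 1) / (z + 1)) ?_ ?_)
    · rw [Complex.div_re, ← add_div]
      refine div_nonneg ?_ (Complex.normSq_nonneg _)
      have h2 : 1 ≤ z.re * z.re + z.im * z.im := by
        rw [← Complex.normSq_apply, Complex.normSq_eq_norm_sq]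
        nlinarith
      simp
      nlinarith
    · rw [div_eq_inv_mul, mul_smul, ← h1, smul_smul, inv_mul_cancel₀ hz1, one_smul]

open scoped Matrix.Norms.Operator in
-- The Cayley transform D replaces the flow exp(tA) by a discrete one. The form xᵀPx strictly
-- decreases under D and tends to 0 along D^k x, so it is positive at every x ≠ 0.
theorem IsHurwitz.posDef_of_lyapunov {n : ℕ} {A P : Matrix (Fin n) (Fin n) ℝ} (hA : IsHurwitz A)
    (hP : Pᵀ = P) (hPA : P * A ∈ negForms n) : P.PosDef := by
  have hdet : (1 - A).det ≠ 0 := by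
    have h1 := hA.det_ne_zero (z := 1) (by simp)
    have h2 : (1 : ℂ) • 1 - toC A = (algebraMap ℝ ℂ).mapMatrix (1 - A) := by
      rw [one_smul, map_sub, map_one]; rfl
    rw [h2, ← RingHom.map_det] at h1
    exact fun h => h1 (by rw [h, map_zero])
  have hu : IsUnit (1 - A).det := isUnit_iff_ne_zero.2 hdet
  set D := (1 + A) * (1 - A)⁻¹ with hD
  have hspec : ∀ z ∈ spectrum ℂ (toC D), ‖z‖ < 1 := by
    intro z hz
    rw [spectrum.mem_iff, Algebra.algebraMap_eq_smul_one, Matrix.isUnit_iff_isUnit_det,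
      isUnit_iff_ne_zero, not_not, ← Matrix.exists_mulVec_eq_zero_iff] at hz
    obtain ⟨v, hv, hzv⟩ := hz
    rw [Matrix.sub_mulVec, Matrix.smul_mulVec, Matrix.one_mulVec, sub_eq_zero] at hzv
    set y := toC (1 - A)⁻¹ *ᵥ v with hy
    have hone : toC (1 : Matrix (Fin n) (Fin n) ℝ) = 1 := Matrix.map_one _ (map_zero _) (map_one _)
    have hvy : v = y - toC A *ᵥ y := by
      have h1 : toC (1 - A) *ᵥ y = v := by
        rw [hy, Matrix.mulVec_mulVec, ← toC_mul, Matrix.mul_nonsing_inv _ hu, hone,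
          Matrix.one_mulVec]
      rw [← h1, toC, Matrix.map_sub _ (fun a b => map_sub (algebraMap ℝ ℂ) a b),
        Matrix.sub_mulVec]
      change toC 1 *ᵥ y - _ = _
      rw [hone, Matrix.one_mulVec]
    have hDv : toC D *ᵥ v = y + toC A *ᵥ y := by
      rw [hD, toC_mul, ← Matrix.mulVec_mulVec, ← hy, toC,
        Matrix.map_add _ (fun a b => map_add (algebraMap ℝ ℂ) a b), Matrix.add_mulVec]
      change toC 1 *ᵥ y + _ = _
      rw [hone, Matrix.one_mulVec]
    have hy0 : y ≠ 0 := by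
      intro h0
      rw [h0, Matrix.mulVec_zero, sub_zero] at hvy
      exact hv hvy
    refine cayley_norm_lt_one hA hy0 ?_
    rw [← hDv, ← hvy, hzv]
  -- With x = y - Ay and Dx = y + Ay the difference of the two forms is 4 yᵀPAy.
  have hV : ∀ x : Fin n → ℝ, x ≠ 0 → (D *ᵥ x) ⬝ᵥ P *ᵥ (D *ᵥ x) < x ⬝ᵥ P *ᵥ x := by
    intro x hx
    set y := (1 - A)⁻¹ *ᵥ x with hy
    have hxy : x = y - A *ᵥ y := by
      have h1 : (1 - A) *ᵥ y = x := by
        rw [hy, Matrix.mulVec_mulVec, Matrix.mul_nonsing_inv _ hu, Matrix.one_mulVec]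
      rw [← h1, Matrix.sub_mulVec, Matrix.one_mulVec]
    have hDx : D *ᵥ x = y + A *ᵥ y := by
      rw [hD, ← Matrix.mulVec_mulVec, ← hy, Matrix.add_mulVec, Matrix.one_mulVec]
    have hy0 : y ≠ 0 := by
      intro h0
      rw [h0, Matrix.mulVec_zero, sub_zero] at hxy
      exact hx hxy
    have h1 := hPA y hy0
    rw [← Matrix.mulVec_mulVec] at h1
    have hsymm : (A *ᵥ y) ⬝ᵥ P *ᵥ y = y ⬝ᵥ P *ᵥ (A *ᵥ y) := by
      rw [Matrix.dotProduct_mulVec, ← Matrix.mulVec_transpose, hP, dotProduct_comm]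
    rw [hDx]
    conv_rhs => rw [hxy]
    simp only [Matrix.mulVec_add, Matrix.mulVec_sub, dotProduct_add, dotProduct_sub,
      add_dotProduct, sub_dotProduct, hsymm]
    linarith
  refine Matrix.PosDef.of_dotProduct_mulVec_pos ?_ fun x hx => ?_
  · rw [Matrix.IsHermitian, Matrix.conjTranspose_eq_transpose_of_trivial, hP]
  · rw [star_trivial]
    obtain ⟨i₀, _⟩ := Function.ne_iff.1 hx
    have : Nonempty (Fin n) := ⟨i₀⟩
    have hpow := tendsto_pow_zero_of_spectrum hspec
    have hpow' : Tendsto (fun k : ℕ => (D ^ k) *ᵥ x) atTop (𝓝 0) := by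
      rw [tendsto_pi_nhds]
      intro i
      have h1 : Continuous fun M : Matrix (Fin n) (Fin n) ℂ =>
          ((M *ᵥ fun j => (x j : ℂ)) i).re :=
        Complex.continuous_re.comp (by
          change Continuous fun M : Matrix (Fin n) (Fin n) ℂ => ∑ j, M i j * (x j : ℂ)
          fun_prop)
      have h2 := (h1.tendsto 0).comp hpow
      simp only [Matrix.zero_mulVec, Pi.zero_apply, Complex.zero_re] at h2
      refine h2.congr fun k => ?_
      have h3 : toC D ^ k = toC (D ^ k) := (map_pow (algebraMap ℝ ℂ).mapMatrix D k).symm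
      simp only [Function.comp_apply, h3, Matrix.mulVec, dotProduct, Matrix.map_apply,
        Complex.re_sum, Complex.coe_algebraMap, Complex.re_ofReal_mul, Complex.ofReal_re]
    have hVc : Continuous fun x : Fin n → ℝ => x ⬝ᵥ P *ᵥ x := by fun_prop
    have hlim := (hVc.tendsto 0).comp hpow'
    simp only [zero_dotProduct] at hlim
    have hle : ∀ x : Fin n → ℝ, (D *ᵥ x) ⬝ᵥ P *ᵥ (D *ᵥ x) ≤ x ⬝ᵥ P *ᵥ x := by
      intro x
      by_cases hx : x = 0
      · simp [hx]
      · exact (hV x hx).le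
    have hanti : Antitone fun k : ℕ => (D ^ k *ᵥ x) ⬝ᵥ P *ᵥ (D ^ k *ᵥ x) := by
      refine antitone_nat_of_succ_le fun k => ?_
      rw [pow_succ', ← Matrix.mulVec_mulVec]
      exact hle _
    have h1 := hanti.le_of_tendsto hlim 1
    simp only [pow_one] at h1
    exact h1.trans_lt (hV x hx)

theorem IsStrictlyPassive.exists_isLyapunovPair {m n : ℕ} {A : Matrix (Fin n) (Fin n) ℝ}
    {B c : Matrix (Fin n) (Fin m) ℝ} (h : IsStrictlyPassive A B c) :
    ∃ P Q : Matrix (Fin n) (Fin n) ℝ, IsLyapunovPair A B c P Q := by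
  obtain ⟨P, hP, hPB, hPA⟩ := h.exists_storage
  refine ⟨P, -(Aᵀ * P + P * A), h.hurwitz.posDef_of_lyapunov hP hPA, ?_, (neg_neg _).symm, hPB⟩
  refine Matrix.PosDef.of_dotProduct_mulVec_pos ?_ fun x hx => ?_
  · rw [Matrix.IsHermitian, Matrix.conjTranspose_eq_transpose_of_trivial, Matrix.transpose_neg,
      Matrix.transpose_add, Matrix.transpose_mul, Matrix.transpose_mul, Matrix.transpose_transpose,
      hP, add_comm]
  · have h1 : x ⬝ᵥ (Aᵀ * P) *ᵥ x = x ⬝ᵥ (P * A) *ᵥ x := by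
      rw [Matrix.dotProduct_mulVec, ← Matrix.mulVec_transpose, Matrix.transpose_mul,
        Matrix.transpose_transpose, hP, dotProduct_comm]
    rw [star_trivial, Matrix.neg_mulVec, Matrix.add_mulVec, dotProduct_neg, dotProduct_add, h1]
    linarith [hPA x hx]

/-! ### Bounded signals -/

/-- A scalar signal is bounded on `[0, ∞)`. -/
def BddOnTime (f : ℝ → ℝ) : Prop := ∃ M : ℝ, ∀ t, 0 ≤ t → |f t| ≤ M

theorem boundedSignal_iff {ι : Type*} [Fintype ι] {f : ℝ → ι → ℝ} :
    BoundedSignal f ↔ ∀ i, BddOnTime fun t => f t i := by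
  refine ⟨fun ⟨M, hM⟩ i => ⟨M, fun t ht => hM t ht i⟩, fun h => ?_⟩
  choose M hM using h
  obtain ⟨K, hK⟩ := (Set.finite_range M).bddAbove
  exact ⟨K, fun t ht i => (hM i t ht).trans (hK ⟨i, rfl⟩)⟩

theorem BddOnTime.congr {f g : ℝ → ℝ} (hf : BddOnTime f) (h : ∀ t, 0 ≤ t → g t = f t) :
    BddOnTime g := by
  obtain ⟨M, hM⟩ := hf
  exact ⟨M, fun t ht => by rw [h t ht]; exact hM t ht⟩

theorem bddOnTime_const (a : ℝ) : BddOnTime fun _ => a := ⟨|a|, fun _ _ => le_rfl⟩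

theorem BddOnTime.add {f g : ℝ → ℝ} (hf : BddOnTime f) (hg : BddOnTime g) :
    BddOnTime fun t => f t + g t := by
  obtain ⟨M, hM⟩ := hf
  obtain ⟨K, hK⟩ := hg
  exact ⟨M + K, fun t ht => (abs_add_le _ _).trans (add_le_add (hM t ht) (hK t ht))⟩

theorem BddOnTime.mul {f g : ℝ → ℝ} (hf : BddOnTime f) (hg : BddOnTime g) :
    BddOnTime fun t => f t * g t := by
  obtain ⟨M, hM⟩ := hf
  obtain ⟨K, hK⟩ := hg
  refine ⟨M * K, fun t ht => ?_⟩
  rw [abs_mul]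
  exact mul_le_mul (hM t ht) (hK t ht) (abs_nonneg _) ((abs_nonneg _).trans (hM t ht))

theorem BddOnTime.sum {ι : Type*} (s : Finset ι) {f : ι → ℝ → ℝ} (hf : ∀ i ∈ s, BddOnTime (f i)) :
    BddOnTime fun t => ∑ i ∈ s, f i t := by
  classical
  induction s using Finset.induction_on with
  | empty => simpa using bddOnTime_const 0
  | insert a s ha ih =>
    simp only [Finset.sum_insert ha]
    exact (hf a (Finset.mem_insert_self a s)).add
      (ih fun i hi => hf i (Finset.mem_insert_of_mem hi))

theorem bddOnTime_mulVec {a b : ℕ} {X : ℝ → Matrix (Fin a) (Fin b) ℝ} {v : ℝ → Fin b → ℝ}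
    (i : Fin a) (hX : ∀ j, BddOnTime fun t => X t i j) (hv : ∀ j, BddOnTime fun t => v t j) :
    BddOnTime fun t => (X t *ᵥ v t) i :=
  BddOnTime.sum Finset.univ fun j _ => (hX j).mul (hv j)

theorem HasDerivOnTime.apply {ι : Type*} [Fintype ι] {f f' : ℝ → ι → ℝ} (h : HasDerivOnTime f f')
    (i : ι) : HasDerivOnTime (fun t => f t i) (fun t => f' t i) :=
  fun t ht => hasDerivWithinAt_pi.1 (h t ht) i

theorem HasDerivOnTime.continuousOn {E : Type*} [NormedAddCommGroup E] [NormedSpace ℝ E]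
    {f f' : ℝ → E} (h : HasDerivOnTime f f') : ContinuousOn f (Set.Ici 0) :=
  fun t ht => (h t ht).continuousWithinAt

theorem HasDerivOnTime.hasDerivAt {E : Type*} [NormedAddCommGroup E] [NormedSpace ℝ E]
    {f f' : ℝ → E} (h : HasDerivOnTime f f') {t : ℝ} (ht : 0 < t) : HasDerivAt f (f' t) t :=
  (h t ht.le).hasDerivAt (Ici_mem_nhds ht)

theorem HasDerivOnTime.antitoneOn {f f' : ℝ → ℝ} (h : HasDerivOnTime f f')
    (hf : ∀ t, 0 ≤ t → f' t ≤ 0) : AntitoneOn f (Set.Ici 0) := by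
  refine antitoneOn_of_hasDerivWithinAt_nonpos (f' := f') (convex_Ici 0) h.continuousOn
    (fun t ht => ?_) fun t ht => hf t (interior_subset ht)
  exact (h t (interior_subset ht)).mono interior_subset

/-- A stable first-order filter maps bounded inputs to bounded outputs. -/
theorem BddOnTime.of_stable_filter {f f' u : ℝ → ℝ} {a : ℝ} (ha : 0 < a) (hf : HasDerivOnTime f f')
    (hf' : ∀ t, 0 ≤ t → f' t = -a * f t + u t) (hu : BddOnTime u) : BddOnTime f := by
  obtain ⟨M, hM⟩ := hu
  have key : ∀ σ : ℝ, |σ| = 1 → ∀ t, 0 ≤ t → σ * f t ≤ |f 0| + |M / a| := by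
    intro σ hσ t ht
    -- This function is nonincreasing because σu ≤ M; the signs σ = 1 and σ = -1 give the two
    -- one-sided bounds.
    have hd : HasDerivOnTime (fun t => Real.exp (a * t) * (σ * f t - M / a))
        (fun t => Real.exp (a * t) * (σ * u t - M)) := by
      intro s hs
      have h1 : HasDerivAt (fun t => Real.exp (a * t)) (Real.exp (a * s) * (a * 1)) s :=
        ((hasDerivAt_id s).const_mul a).exp
      have h2 := h1.hasDerivWithinAt.mul (((hf s hs).const_mul σ).sub_const (M / a))
      refine h2.congr_deriv ?_
      rw [hf' s hs]
      field_simp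
      ring
    have hanti := hd.antitoneOn (fun s hs => by
      refine mul_nonpos_of_nonneg_of_nonpos (Real.exp_pos _).le ?_
      have h1 : σ * u s ≤ |σ * u s| := le_abs_self _
      rw [abs_mul, hσ, one_mul] at h1
      linarith [hM s hs])
    have h1 := hanti (Set.mem_Ici.2 le_rfl) (Set.mem_Ici.2 ht) ht
    simp only [mul_zero, Real.exp_zero, one_mul] at h1
    have h2 : 1 ≤ Real.exp (a * t) := Real.one_le_exp (by positivity)
    have h3 : σ * f 0 ≤ |f 0| := by
      have := le_abs_self (σ * f 0)
      rwa [abs_mul, hσ, one_mul] at this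
    have h4 := neg_abs_le (M / a)
    have h5 := le_abs_self (M / a)
    by_cases hneg : σ * f t - M / a ≤ 0
    · linarith [abs_nonneg (f 0)]
    · push Not at hneg
      nlinarith
  refine ⟨|f 0| + |M / a|, fun t ht => abs_le'.2 ⟨?_, ?_⟩⟩
  · simpa using key 1 (by simp) t ht
  · simpa using key (-1) (by simp) t ht

open MeasureTheory in
/-- A square integrable bounded signal with bounded derivative tends to zero. -/
theorem tendsto_zero_of_sq_integrable {f f' : ℝ → ℝ} (hf : HasDerivOnTime f f')
    (hb : BddOnTime f) (hb' : BddOnTime f') (hint : IntegrableOn (fun t => f t ^ 2) (Set.Ici 0)) :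
    Tendsto f atTop (𝓝 0) := by
  obtain ⟨M, hM⟩ := hb
  obtain ⟨K, hK⟩ := hb'
  have hint := hint.mono_set Set.Ioi_subset_Ici_self
  have hcont : ContinuousOn f (Set.Ioi 0) := hf.continuousOn.mono Set.Ioi_subset_Ici_self
  -- Both f³ and its derivative 3f²f' are dominated by a multiple of f², hence integrable, and such
  -- a function tends to 0.
  have hderiv : ∀ t ∈ Set.Ioi (0 : ℝ), HasDerivAt (fun t => f t ^ 3) (3 * f t ^ 2 * deriv f t) t := by
    intro t ht
    have h1 := hf.hasDerivAt ht
    rw [h1.deriv]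
    simpa using h1.fun_pow 3
  have hI : IntegrableOn (fun t => 3 * f t ^ 2 * deriv f t) (Set.Ioi 0) := by
    refine Integrable.mono' (hint.const_mul (3 * K)) ?_ ?_
    · refine ((hcont.pow 2).const_mul 3 |>.aestronglyMeasurable measurableSet_Ioi).mul ?_
      exact (measurable_deriv f).aestronglyMeasurable
    · refine (ae_restrict_iff' measurableSet_Ioi).2 (ae_of_all _ fun t ht => ?_)
      rw [(hf.hasDerivAt ht).deriv, Real.norm_eq_abs, abs_mul, abs_of_nonneg (by positivity)]
      nlinarith [hK t (le_of_lt ht), sq_nonneg (f t)]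
  have hJ : IntegrableOn (fun t => f t ^ 3) (Set.Ioi 0) := by
    refine Integrable.mono' (hint.const_mul M) ?_ ?_
    · exact (hcont.pow 3).aestronglyMeasurable measurableSet_Ioi
    · refine (ae_restrict_iff' measurableSet_Ioi).2 (ae_of_all _ fun t ht => ?_)
      rw [Real.norm_eq_abs, abs_pow, pow_succ, sq_abs, mul_comm]
      exact mul_le_mul_of_nonneg_right (hM t (le_of_lt ht)) (sq_nonneg _)
  have h3 := tendsto_zero_of_hasDerivAt_of_integrableOn_Ioi hderiv hI hJ
  rw [tendsto_zero_iff_abs_tendsto_zero] at h3 ⊢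
  have h4 := h3.rpow_const (p := (1 / 3 : ℝ)) (Or.inr (by norm_num))
  rw [Real.zero_rpow (by norm_num)] at h4
  refine h4.congr fun t => ?_
  simp only [Function.comp_apply]
  rw [abs_pow, ← Real.rpow_natCast, ← Real.rpow_mul (abs_nonneg _)]
  norm_num

/-! ### The network -/

/-- The grounded Laplacian of the network is invertible. -/
theorem Network.exists_left_inverse {m : ℕ} (N : Network m) :
    ∃ L : Matrix (Fin m) (Fin m) ℝ, L * (1 - Matrix.of N.w) = 1 := by
  suffices h : (1 - Matrix.of N.w).det ≠ 0 from
    ⟨(1 - Matrix.of N.w)⁻¹, Matrix.nonsing_inv_mul _ (isUnit_iff_ne_zero.2 h)⟩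
  intro hdet
  obtain ⟨v, hv, hv0⟩ := Matrix.exists_mulVec_eq_zero_iff.2 hdet
  rw [Matrix.sub_mulVec, Matrix.one_mulVec, sub_eq_zero] at hv0
  have hfix : ∀ i, v i = ∑ j, N.w i j * v j := fun i => congrFun hv0 i
  obtain ⟨i₁, hi₁⟩ := Function.ne_iff.1 hv
  have : Nonempty (Fin m) := ⟨i₁⟩
  obtain ⟨i₀, hmax⟩ := Finite.exists_max fun i => |v i|
  have hM : 0 < |v i₀| := (abs_pos.2 hi₁).trans_le (hmax i₁)
  -- Maximum principle for a kernel vector: where |v| is maximal, no weight can go to the leader or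
  -- to a smaller neighbour. Following a path back to the leader contradicts reachability.
  have step : ∀ i, |v i| = |v i₀| → N.w0 i = 0 ∧ ∀ j, 0 < N.w i j → |v j| = |v i₀| := by
    intro i hi
    have h1 : |v i₀| ≤ ∑ j, N.w i j * |v j| := by
      rw [← hi, hfix i]
      refine (Finset.abs_sum_le_sum_abs _ _).trans (Finset.sum_le_sum fun j _ => ?_)
      rw [abs_mul, abs_of_nonneg (N.w_nonneg i j)]
    have h2 : ∑ j, N.w i j * (|v i₀| - |v j|) + N.w0 i * |v i₀| ≤ 0 := by
      have h3 := N.balance i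
      simp only [mul_sub, Finset.sum_sub_distrib, ← Finset.sum_mul]
      nlinarith
    have h4 : ∀ j ∈ Finset.univ, 0 ≤ N.w i j * (|v i₀| - |v j|) := fun j _ =>
      mul_nonneg (N.w_nonneg i j) (sub_nonneg.2 (hmax j))
    have h5 := Finset.sum_nonneg h4
    have h6 : 0 ≤ N.w0 i * |v i₀| := mul_nonneg (N.w0_nonneg i) hM.le
    refine ⟨?_, fun j hj => ?_⟩
    · have h7 : N.w0 i * |v i₀| = 0 := by linarith
      exact (mul_eq_zero.1 h7).resolve_right hM.ne'
    · have h7 := (Finset.sum_eq_zero_iff_of_nonneg h4).1 (by linarith) j (Finset.mem_univ j)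
      have h8 := (mul_eq_zero.1 h7).resolve_left hj.ne'
      linarith
  obtain ⟨j, hj, hpath⟩ := N.reachable i₀
  have hall : ∀ {a}, Relation.ReflTransGen (fun a b => 0 < N.w b a) a i₀ → |v a| = |v i₀| := by
    intro a ha
    induction ha using Relation.ReflTransGen.head_induction_on with
    | refl => rfl
    | head hab _ ih => exact (step _ ih).2 _ hab
  exact hj.ne' (step j (hall hpath)).1

namespace Signals

variable {m n : ℕ}

/-- Because incoming weights sum to one, e_y = -(I - w)(y - y₀𝟏). -/
theorem sub_leader_eq (S : Signals m n) (N : Network m) (θ : Fin m → ℝ) (θ0 : ℝ)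
    {L : Matrix (Fin m) (Fin m) ℝ} (hL : L * (1 - Matrix.of N.w) = 1) (t : ℝ) (i : Fin m) :
    S.y θ t i - S.y0 θ0 t = (-L *ᵥ S.ey N θ θ0 t) i := by
  have h1 : S.ey N θ θ0 t = -((1 - Matrix.of N.w) *ᵥ fun i => S.y θ t i - S.y0 θ0 t) := by
    funext i
    have h2 := N.balance i
    rw [Matrix.sub_mulVec, Matrix.one_mulVec]
    simp only [ey, Pi.neg_apply, Pi.sub_apply, Matrix.mulVec, dotProduct, Matrix.of_apply, mul_sub,
      Finset.sum_sub_distrib, ← Finset.sum_mul]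
    linear_combination S.y0 θ0 t * h2
  rw [h1, Matrix.neg_mulVec, Matrix.mulVec_neg, neg_neg, Matrix.mulVec_mulVec, hL,
    Matrix.one_mulVec]

end Signals

/-! ### Lyapunov analysis of the adaptive loop -/

/-- Negative definiteness is an open condition, so -P + μI keeps it for small μ > 0. -/
theorem exists_le_quadratic_form {n : ℕ} {P : Matrix (Fin n) (Fin n) ℝ} (hP : P.PosDef) :
    ∃ μ : ℝ, 0 < μ ∧ ∀ x : Fin n → ℝ, μ * ∑ i, x i ^ 2 ≤ x ⬝ᵥ P *ᵥ x := by
  have hc : Continuous fun s : ℝ => -P + s • (1 : Matrix (Fin n) (Fin n) ℝ) := by fun_prop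
  have h0 : -P + (0 : ℝ) • (1 : Matrix (Fin n) (Fin n) ℝ) ∈ negForms n := by
    intro x hx
    rw [zero_smul, add_zero, Matrix.neg_mulVec, dotProduct_neg, neg_lt_zero]
    simpa using hP.dotProduct_mulVec_pos hx
  have hev := hc.continuousAt.eventually ((isOpen_negForms n).mem_nhds h0)
  obtain ⟨μ, hμ, hμ0⟩ := ((hev.filter_mono (nhdsWithin_le_nhds (s := Set.Ioi 0))).and
    self_mem_nhdsWithin).exists
  refine ⟨μ, hμ0, fun x => ?_⟩
  by_cases hx : x = 0
  · simp [hx]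
  · have h1 := hμ x hx
    rw [Matrix.add_mulVec, Matrix.neg_mulVec, Matrix.smul_mulVec, Matrix.one_mulVec,
      dotProduct_add, dotProduct_neg, dotProduct_smul, smul_eq_mul] at h1
    have h2 : x ⬝ᵥ x = ∑ i, x i ^ 2 := by simp only [dotProduct, sq]
    rw [h2] at h1
    linarith

theorem trace_weighted {m : ℕ} {g : Fin m → ℝ} (hg : ∀ i, 0 < g i)
    (X : Matrix (Fin m) (Fin m) ℝ) :
    (Xᵀ * (Matrix.diagonal g)⁻¹ * X).trace = ∑ i, ∑ j, X i j ^ 2 / g i := by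
  have h1 : (Matrix.diagonal g)⁻¹ = Matrix.diagonal fun i => (g i)⁻¹ := by
    apply Matrix.inv_eq_right_inv
    rw [Matrix.diagonal_mul_diagonal, ← Matrix.diagonal_one]
    congr 1
    funext i
    exact mul_inv_cancel₀ (hg i).ne'
  rw [h1, Finset.sum_comm]
  simp only [Matrix.trace, Matrix.diag_apply]
  refine Finset.sum_congr rfl fun j _ => ?_
  rw [Matrix.mul_apply]
  refine Finset.sum_congr rfl fun i _ => ?_
  rw [Matrix.mul_diagonal, Matrix.transpose_apply, div_eq_mul_inv]
  ring

theorem HasDerivOnTime.quadratic_form {n : ℕ} {e e' : ℝ → Fin n → ℝ} (he : HasDerivOnTime e e')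
    (P : Matrix (Fin n) (Fin n) ℝ) :
    HasDerivOnTime (fun t => e t ⬝ᵥ P *ᵥ e t)
      (fun t => e' t ⬝ᵥ P *ᵥ e t + e t ⬝ᵥ P *ᵥ e' t) := by
  intro t ht
  have hi := fun i => he.apply i t ht
  have hP : ∀ i, HasDerivWithinAt (fun t => (P *ᵥ e t) i) ((P *ᵥ e' t) i) (Set.Ici 0) t := fun i =>
    HasDerivWithinAt.fun_sum (u := Finset.univ) fun j _ => (hi j).const_mul (P i j)
  have h := HasDerivWithinAt.fun_sum (u := Finset.univ) fun i (_ : i ∈ Finset.univ) =>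
    (hi i).mul (hP i)
  rw [Finset.sum_add_distrib] at h
  exact h

theorem transpose_dotProduct_mulVec {a b : ℕ} (M : Matrix (Fin a) (Fin b) ℝ) (x : Fin b → ℝ)
    (y : Fin a → ℝ) : (M *ᵥ x) ⬝ᵥ y = x ⬝ᵥ Mᵀ *ᵥ y := by
  rw [dotProduct_comm, Matrix.dotProduct_mulVec, ← Matrix.mulVec_transpose, dotProduct_comm]

theorem IsLyapunovPair.symm {m n : ℕ} {A P Q : Matrix (Fin n) (Fin n) ℝ}
    {B c : Matrix (Fin n) (Fin m) ℝ} (h : IsLyapunovPair A B c P Q) : Pᵀ = P := by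
  have := h.posDef_P.isHermitian
  rwa [Matrix.IsHermitian, Matrix.conjTranspose_eq_transpose_of_trivial] at this

theorem IsLyapunovPair.storage_rate {m n : ℕ} {A P Q : Matrix (Fin n) (Fin n) ℝ}
    {B c : Matrix (Fin n) (Fin m) ℝ} (h : IsLyapunovPair A B c P Q) (e : Fin n → ℝ)
    (v : Fin m → ℝ) :
    (A *ᵥ e + B *ᵥ v) ⬝ᵥ P *ᵥ e + e ⬝ᵥ P *ᵥ (A *ᵥ e + B *ᵥ v) =
      -(e ⬝ᵥ Q *ᵥ e) + 2 * ((cᵀ *ᵥ e) ⬝ᵥ v) := by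
  have h1 : (A *ᵥ e) ⬝ᵥ P *ᵥ e + e ⬝ᵥ P *ᵥ (A *ᵥ e) = -(e ⬝ᵥ Q *ᵥ e) := by
    rw [transpose_dotProduct_mulVec, Matrix.mulVec_mulVec, Matrix.mulVec_mulVec, ← dotProduct_add,
      ← Matrix.add_mulVec, h.lyapunov, Matrix.neg_mulVec, dotProduct_neg]
  have h2 : e ⬝ᵥ P *ᵥ (B *ᵥ v) = (cᵀ *ᵥ e) ⬝ᵥ v := by
    rw [Matrix.mulVec_mulVec, h.output, transpose_dotProduct_mulVec, Matrix.transpose_transpose]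
  have h3 : (B *ᵥ v) ⬝ᵥ P *ᵥ e = (cᵀ *ᵥ e) ⬝ᵥ v := by
    rw [← h2, dotProduct_comm, transpose_dotProduct_mulVec, h.symm]
  rw [Matrix.mulVec_add, add_dotProduct, dotProduct_add]
  linarith

namespace Signals.IsAdaptiveLoop

variable {m n : ℕ} {S : Signals m n} {N : Network m} {φ p q θ : Fin m → ℝ} {θ0 : ℝ}
  {Γ : Fin 3 → Fin m → ℝ} {A : Matrix (Fin n) (Fin n) ℝ} {B c : Matrix (Fin n) (Fin m) ℝ}

/-- PB = c turns the cross term of the storage rate into 2 e_yᵀΞη; the parameter term contributes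
exactly its negative, since the division by Γ undoes the gain in the gradient law. -/
theorem lyapunov_hasDeriv (h : S.IsAdaptiveLoop N φ p q θ θ0 Γ A B c) (hΓ : ∀ l i, 0 < Γ l i)
    {P Q : Matrix (Fin n) (Fin n) ℝ} (hPQ : IsLyapunovPair A B c P Q) :
    HasDerivOnTime (S.lyapunov P Γ) fun t => -(S.ex t ⬝ᵥ Q *ᵥ S.ex t) := by
  have hfun : S.lyapunov P Γ = fun t => S.ex t ⬝ᵥ P *ᵥ S.ex t
      + ∑ l, ∑ i, ∑ j, S.Ξ t l i j ^ 2 / Γ l i := by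
    funext t
    simp only [Signals.lyapunov, trace_weighted (hΓ _)]
  rw [hfun]
  intro t ht
  have h1 := h.error_state.quadratic_form P t ht
  have h2 : HasDerivWithinAt (fun t => ∑ l, ∑ i, ∑ j, S.Ξ t l i j ^ 2 / Γ l i)
      (∑ l, ∑ i, ∑ j, -2 * (S.ey N θ θ0 t i * (S.Ξ t l i j * S.η N θ θ0 t l j)))
      (Set.Ici 0) t := by
    refine HasDerivWithinAt.fun_sum fun l _ => HasDerivWithinAt.fun_sum fun i _ =>
      HasDerivWithinAt.fun_sum fun j _ => ?_
    refine (((h.gradient_law l i j t ht).fun_pow 2).div_const (Γ l i)).congr_deriv ?_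
    beta_reduce
    rw [Matrix.diagonal_mul, Matrix.vecMulVec_apply]
    have := (hΓ l i).ne'
    field_simp
    norm_num
    ring
  refine (h1.add h2).congr_deriv ?_
  beta_reduce
  rw [hPQ.storage_rate, ← h.error_output t ht]
  have h3 : S.ey N θ θ0 t ⬝ᵥ S.mismatch N θ θ0 t =
      ∑ l, ∑ i, ∑ j, S.ey N θ θ0 t i * (S.Ξ t l i j * S.η N θ θ0 t l j) := by
    rw [Signals.mismatch, dotProduct_sum]
    simp only [dotProduct, Matrix.mulVec, Finset.mul_sum]
  simp only [h3, Finset.mul_sum]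
  simp only [← Finset.mul_sum]
  ring

theorem quadratic_le_lyapunov (hΓ : ∀ l i, 0 < Γ l i) (P : Matrix (Fin n) (Fin n) ℝ) (t : ℝ) :
    S.ex t ⬝ᵥ P *ᵥ S.ex t ≤ S.lyapunov P Γ t := by
  simp only [Signals.lyapunov, trace_weighted (hΓ _)]
  refine le_add_of_nonneg_right (Finset.sum_nonneg fun l _ => Finset.sum_nonneg fun i _ =>
    Finset.sum_nonneg fun j _ => div_nonneg (sq_nonneg _) (hΓ l i).le)

theorem parameter_sq_le_lyapunov (hΓ : ∀ l i, 0 < Γ l i) {P : Matrix (Fin n) (Fin n) ℝ}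
    (hP : P.PosDef) (t : ℝ) (l : Fin 3) (i j : Fin m) :
    S.Ξ t l i j ^ 2 ≤ Γ l i * S.lyapunov P Γ t := by
  have h0 : 0 ≤ S.ex t ⬝ᵥ P *ᵥ S.ex t := by
    simpa using hP.posSemidef.dotProduct_mulVec_nonneg (S.ex t)
  have hnn : ∀ l i j, 0 ≤ S.Ξ t l i j ^ 2 / Γ l i := fun l i j =>
    div_nonneg (sq_nonneg _) (hΓ l i).le
  rw [mul_comm, ← div_le_iff₀ (hΓ l i)]
  simp only [Signals.lyapunov, trace_weighted (hΓ _)]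
  refine le_add_of_nonneg_of_le h0 ?_
  refine le_trans ?_ (Finset.single_le_sum (f := fun l => ∑ i, ∑ j, S.Ξ t l i j ^ 2 / Γ l i)
    (fun l _ => Finset.sum_nonneg fun i _ => Finset.sum_nonneg fun j _ => hnn l i j)
    (Finset.mem_univ l))
  refine le_trans ?_ (Finset.single_le_sum (f := fun i => ∑ j, S.Ξ t l i j ^ 2 / Γ l i)
    (fun i _ => Finset.sum_nonneg fun j _ => hnn l i j) (Finset.mem_univ i))
  exact Finset.single_le_sum (f := fun j => S.Ξ t l i j ^ 2 / Γ l i)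
    (fun j _ => hnn l i j) (Finset.mem_univ j)

theorem quadratic_nonneg {Q : Matrix (Fin n) (Fin n) ℝ} (hQ : Q.PosDef) (e : Fin n → ℝ) :
    0 ≤ e ⬝ᵥ Q *ᵥ e := by
  simpa using hQ.posSemidef.dotProduct_mulVec_nonneg e

theorem lyapunov_antitoneOn (h : S.IsAdaptiveLoop N φ p q θ θ0 Γ A B c) (hΓ : ∀ l i, 0 < Γ l i)
    {P Q : Matrix (Fin n) (Fin n) ℝ} (hPQ : IsLyapunovPair A B c P Q) :
    AntitoneOn (S.lyapunov P Γ) (Set.Ici 0) :=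
  (h.lyapunov_hasDeriv hΓ hPQ).antitoneOn fun t _ =>
    neg_nonpos.2 (quadratic_nonneg hPQ.posDef_Q (S.ex t))

theorem ex_bounded (h : S.IsAdaptiveLoop N φ p q θ θ0 Γ A B c) (hΓ : ∀ l i, 0 < Γ l i)
    {P Q : Matrix (Fin n) (Fin n) ℝ} (hPQ : IsLyapunovPair A B c P Q) (i : Fin n) :
    BddOnTime fun t => S.ex t i := by
  obtain ⟨μ, hμ, hμP⟩ := exists_le_quadratic_form hPQ.posDef_P
  refine ⟨√(S.lyapunov P Γ 0 / μ), fun t ht => Real.abs_le_sqrt ?_⟩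
  rw [le_div_iff₀ hμ, mul_comm]
  have h1 : S.ex t i ^ 2 ≤ ∑ i, S.ex t i ^ 2 :=
    Finset.single_le_sum (f := fun i => S.ex t i ^ 2) (fun _ _ => sq_nonneg _) (Finset.mem_univ i)
  calc μ * S.ex t i ^ 2 ≤ μ * ∑ i, S.ex t i ^ 2 := mul_le_mul_of_nonneg_left h1 hμ.le
    _ ≤ _ := hμP _
    _ ≤ _ := quadratic_le_lyapunov hΓ P t
    _ ≤ _ := h.lyapunov_antitoneOn hΓ hPQ (Set.mem_Ici.2 le_rfl) (Set.mem_Ici.2 ht) ht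

theorem parameter_bounded (h : S.IsAdaptiveLoop N φ p q θ θ0 Γ A B c) (hΓ : ∀ l i, 0 < Γ l i)
    {P Q : Matrix (Fin n) (Fin n) ℝ} (hPQ : IsLyapunovPair A B c P Q) (l : Fin 3) (i j : Fin m) :
    BddOnTime fun t => S.Ξ t l i j := by
  refine ⟨√(Γ l i * S.lyapunov P Γ 0), fun t ht => Real.abs_le_sqrt ?_⟩
  refine (parameter_sq_le_lyapunov hΓ hPQ.posDef_P t l i j).trans
    (mul_le_mul_of_nonneg_left ?_ (hΓ l i).le)
  exact h.lyapunov_antitoneOn hΓ hPQ (Set.mem_Ici.2 le_rfl) (Set.mem_Ici.2 ht) ht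

theorem ey_bounded (h : S.IsAdaptiveLoop N φ p q θ θ0 Γ A B c) (hΓ : ∀ l i, 0 < Γ l i)
    {P Q : Matrix (Fin n) (Fin n) ℝ} (hPQ : IsLyapunovPair A B c P Q) (i : Fin m) :
    BddOnTime fun t => S.ey N θ θ0 t i :=
  (bddOnTime_mulVec i (fun j => bddOnTime_const (cᵀ i j)) fun j => h.ex_bounded hΓ hPQ j).congr
    fun t ht => congrFun (h.error_output t ht) i

open MeasureTheory in
theorem squareIntegrable (h : S.IsAdaptiveLoop N φ p q θ θ0 Γ A B c) (hΓ : ∀ l i, 0 < Γ l i)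
    {P Q : Matrix (Fin n) (Fin n) ℝ} (hPQ : IsLyapunovPair A B c P Q) :
    SquareIntegrableSignal S.ex := by
  have hd := h.lyapunov_hasDeriv hΓ hPQ
  have hanti := h.lyapunov_antitoneOn hΓ hPQ
  -- Freezing V at its initial value for negative times makes it monotone on the whole line. It then
  -- converges, so its derivative -e_xᵀQe_x is integrable.
  have hmono : Antitone fun t : ℝ => S.lyapunov P Γ (max t 0) := fun s t hst =>
    hanti (Set.mem_Ici.2 (le_max_right _ _)) (Set.mem_Ici.2 (le_max_right _ _))
      (max_le_max hst le_rfl)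
  have hbdd : BddBelow (Set.range fun t : ℝ => S.lyapunov P Γ (max t 0)) := by
    refine ⟨0, ?_⟩
    rintro _ ⟨t, rfl⟩
    exact (quadratic_nonneg hPQ.posDef_P _).trans (quadratic_le_lyapunov hΓ P _)
  have hlim := (tendsto_atTop_ciInf hmono hbdd).congr' (f₂ := S.lyapunov P Γ) (by
    filter_upwards [eventually_ge_atTop 0] with t ht
    rw [max_eq_left ht])
  have hint := integrableOn_Ioi_deriv_of_nonpos (hd 0 le_rfl).continuousWithinAt
    (fun t ht => hd.hasDerivAt ht)
    (fun t _ => neg_nonpos.2 (quadratic_nonneg hPQ.posDef_Q (S.ex t))) hlim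
  obtain ⟨μ, hμ, hμQ⟩ := exists_le_quadratic_form hPQ.posDef_Q
  rw [SquareIntegrableSignal, integrableOn_Ici_iff_integrableOn_Ioi]
  refine Integrable.mono' (hint.neg.const_mul μ⁻¹) ?_ (ae_of_all _ fun t => ?_)
  · refine ContinuousOn.aestronglyMeasurable ?_ measurableSet_Ioi
    refine ContinuousOn.mono ?_ Set.Ioi_subset_Ici_self
    exact continuousOn_finsetSum _ fun i _ => (h.error_state.apply i).continuousOn.pow 2
  · rw [Real.norm_of_nonneg (Finset.sum_nonneg fun i _ => sq_nonneg _), Pi.neg_apply, neg_neg,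
      inv_mul_eq_div, le_div_iff₀ hμ, mul_comm]
    exact hμQ _

theorem filtered_bounded {u : ℝ → ℝ} {v : ℝ → Fin m → ℝ} (hp : ∀ i, 0 < p i)
    (hv : IsInverseLeadFiltered φ p q u v) (hu : BddOnTime u) (i : Fin m) :
    BddOnTime fun t => v t i := by
  obtain ⟨ζ, hζ, hv⟩ := hv
  have h1 : BddOnTime fun t => ζ t i :=
    BddOnTime.of_stable_filter (hp i) (hζ.apply i) (fun t _ => rfl) hu
  exact ((bddOnTime_const (φ i)⁻¹).mul (hu.add ((bddOnTime_const (q i - p i)).mul h1))).congr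
    fun t ht => hv t ht i

theorem regressor_bounded (h : S.IsAdaptiveLoop N φ p q θ θ0 Γ A B c) (hp : ∀ i, 0 < p i)
    (hΓ : ∀ l i, 0 < Γ l i) {P Q : Matrix (Fin n) (Fin n) ℝ} (hPQ : IsLyapunovPair A B c P Q)
    (hdx : BddOnTime S.dx0) (hddx : BddOnTime S.ddx0) (l : Fin 3) (i : Fin m) :
    BddOnTime fun t => S.η N θ θ0 t l i := by
  fin_cases l
  · exact h.ey_bounded hΓ hPQ i
  · exact filtered_bounded hp h.filtered_acceleration hddx i
  · exact filtered_bounded hp h.filtered_velocity hdx i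

theorem ex_tendsto (h : S.IsAdaptiveLoop N φ p q θ θ0 Γ A B c) (hp : ∀ i, 0 < p i)
    (hΓ : ∀ l i, 0 < Γ l i) {P Q : Matrix (Fin n) (Fin n) ℝ} (hPQ : IsLyapunovPair A B c P Q)
    (hdx : BddOnTime S.dx0) (hddx : BddOnTime S.ddx0) : Tendsto S.ex atTop (𝓝 0) := by
  rw [tendsto_pi_nhds]
  intro i
  have hmis : ∀ j, BddOnTime fun t => S.mismatch N θ θ0 t j := by
    intro j
    refine BddOnTime.congr (f := fun t => ∑ l, (S.Ξ t l *ᵥ S.η N θ θ0 t l) j)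
      (BddOnTime.sum _ fun l _ => bddOnTime_mulVec j (fun k => h.parameter_bounded hΓ hPQ l j k)
        fun k => h.regressor_bounded hp hΓ hPQ hdx hddx l k) fun t _ => ?_
    rw [Signals.mismatch, Finset.sum_apply]
  refine tendsto_zero_of_sq_integrable (h.error_state.apply i) (h.ex_bounded hΓ hPQ i) ?_ ?_
  · exact (bddOnTime_mulVec i (fun j => bddOnTime_const (A i j))
      fun j => h.ex_bounded hΓ hPQ j).add (bddOnTime_mulVec i (fun j => bddOnTime_const (B i j)) hmis)
  · refine MeasureTheory.Integrable.mono' (h.squareIntegrable hΓ hPQ) ?_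
      (MeasureTheory.ae_of_all _ fun t => ?_)
    · exact ((h.error_state.apply i).continuousOn.pow 2).aestronglyMeasurable measurableSet_Ici
    · rw [Real.norm_of_nonneg (sq_nonneg _)]
      exact Finset.single_le_sum (f := fun i => S.ex t i ^ 2) (fun _ _ => sq_nonneg _)
        (Finset.mem_univ i)

theorem ey_tendsto (h : S.IsAdaptiveLoop N φ p q θ θ0 Γ A B c)
    (hex : Tendsto S.ex atTop (𝓝 0)) : Tendsto (S.ey N θ θ0) atTop (𝓝 0) := by
  have hc : Continuous fun e : Fin n → ℝ => cᵀ *ᵥ e := by fun_prop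
  have h1 := (hc.tendsto 0).comp hex
  rw [Matrix.mulVec_zero] at h1
  refine h1.congr' ?_
  filter_upwards [eventually_ge_atTop 0] with t ht
  exact (h.error_output t ht).symm

theorem follower_tendsto (hey : Tendsto (S.ey N θ θ0) atTop (𝓝 0)) (i : Fin m) :
    Tendsto (fun t => S.y θ t i - S.y0 θ0 t) atTop (𝓝 0) := by
  obtain ⟨L, hL⟩ := N.exists_left_inverse
  have hc : Continuous fun e : Fin m → ℝ => (-L *ᵥ e) i :=
    (continuous_apply i).comp (by fun_prop : Continuous fun e : Fin m → ℝ => -L *ᵥ e)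
  have h1 := (hc.tendsto 0).comp hey
  rw [Matrix.mulVec_zero] at h1
  exact h1.congr fun t => (S.sub_leader_eq N θ θ0 hL t i).symm

theorem output_bounded (h : S.IsAdaptiveLoop N φ p q θ θ0 Γ A B c) (hΓ : ∀ l i, 0 < Γ l i)
    {P Q : Matrix (Fin n) (Fin n) ℝ} (hPQ : IsLyapunovPair A B c P Q)
    (hdx : BddOnTime S.dx0) (hx : BddOnTime S.x0) (i : Fin m) :
    BddOnTime fun t => S.y θ t i := by
  obtain ⟨L, hL⟩ := N.exists_left_inverse
  have hy0 : BddOnTime (S.y0 θ0) := hdx.add ((bddOnTime_const θ0).mul hx)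
  refine ((bddOnTime_mulVec i (fun j => bddOnTime_const ((-L) i j))
    fun j => h.ey_bounded hΓ hPQ j).add hy0).congr fun t _ => ?_
  rw [← S.sub_leader_eq N θ θ0 hL t i, sub_add_cancel]

/-- The shaped output drives the stable filter ẋ = -θx + y. -/
theorem position_bounded (h : S.IsAdaptiveLoop N φ p q θ θ0 Γ A B c) (hθ : ∀ i, 0 < θ i)
    {i : Fin m} (hy : BddOnTime fun t => S.y θ t i) : BddOnTime fun t => S.x t i :=
  BddOnTime.of_stable_filter (hθ i) (h.follower_velocity.apply i)
    (fun t _ => by simp only [Signals.y]; ring) hy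

theorem velocity_bounded {i : Fin m} (hy : BddOnTime fun t => S.y θ t i)
    (hx : BddOnTime fun t => S.x t i) : BddOnTime fun t => S.dx t i :=
  (hy.add ((bddOnTime_const (-θ i)).mul hx)).congr fun t _ => by simp only [Signals.y]; ring

end Signals.IsAdaptiveLoop

end

end ShapedSync

theorem mainTheorem3 (m : ℕ) (J b φ p q θ : Fin m → ℝ)
    (hJ : ∀ i, 0 < J i) (hφ : ∀ i, 0 < φ i) (hp : ∀ i, 0 < p i) (hpq : ∀ i, p i < q i)
    (hθ : ∀ i, 0 < θ i) :
    -- `W_w` is the transfer matrix from `r` to `y = (s I + Θ) x` of the loop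
    -- `(J s² + B s) x = C_w (r - K⋆ y)`
    (∀ (k : Fin m → ℝ) (r x y : Fin m → RatFunc ℝ),
      y = Matrix.mulVec (sId m + diagGain θ) x →
      Matrix.mulVec (diagGain J * sId m ^ 2 + diagGain b * sId m) x =
        Matrix.mulVec (leadController φ p q) (r - Matrix.mulVec (diagGain k) y) →
      y = Matrix.mulVec (shapedTransfer J b φ p q θ k) r) ∧
    -- output shaping makes `W_w` strictly positive real, for all large feedback gains
    (∃ κ : ℝ, ∀ k : Fin m → ℝ, (∀ i, κ ≤ k i) → IsSPR (shapedTransfer J b φ p q θ k)) ∧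
    -- whenever `W_w` is strictly positive real
    (∀ k : Fin m → ℝ, IsSPR (shapedTransfer J b φ p q θ k) →
      ∀ (n : ℕ) (A : Matrix (Fin n) (Fin n) ℝ) (B c : Matrix (Fin n) (Fin m) ℝ),
        IsStableRealization (shapedTransfer J b φ p q θ k) A B c →
        (∃ P Q : Matrix (Fin n) (Fin n) ℝ, IsLyapunovPair A B c P Q) ∧
        ∀ (N : Network m) (θ0 : ℝ) (Γ : Fin 3 → Fin m → ℝ), (∀ l i, 0 < Γ l i) →
          ∀ S : Signals m n, S.IsAdaptiveLoop N φ p q θ θ0 Γ A B c →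
            -- the Lyapunov function is nonincreasing
            (∀ P Q : Matrix (Fin n) (Fin n) ℝ, IsLyapunovPair A B c P Q → ∀ t, 0 ≤ t →
              HasDerivWithinAt (S.lyapunov P Γ)
                (-(dotProduct (S.ex t) (Matrix.mulVec Q (S.ex t)))) (Set.Ici 0) t ∧
              -(dotProduct (S.ex t) (Matrix.mulVec Q (S.ex t))) ≤ 0) ∧
            BoundedSignal S.ex ∧
            BoundedSignal (S.ey N θ θ0) ∧
            (∀ l i, BoundedSignal (fun t => S.Ξ t l i)) ∧
            SquareIntegrableSignal S.ex ∧
            -- convergence, for a leader with bounded velocity and acceleration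
            ((∃ M : ℝ, ∀ t, 0 ≤ t → |S.dx0 t| ≤ M ∧ |S.ddx0 t| ≤ M) →
              (∀ l, BoundedSignal (fun t => S.η N θ θ0 t l)) ∧
              Filter.Tendsto S.ex Filter.atTop (nhds 0) ∧
              Filter.Tendsto (S.ey N θ θ0) Filter.atTop (nhds 0) ∧
              (∀ i, Filter.Tendsto (fun t => S.y θ t i - S.y0 θ0 t) Filter.atTop (nhds 0)) ∧
              -- the follower signals are bounded if the leader position is bounded as well
              ((∃ M : ℝ, ∀ t, 0 ≤ t → |S.x0 t| ≤ M) →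
                BoundedSignal (S.y θ) ∧ BoundedSignal S.x ∧ BoundedSignal S.dx))) := by
  refine ⟨fun k r x y hy hx => closedLoop_transfer hJ b φ p q θ k r x y hy hx,
    exists_gain_isSPR b q hJ hφ hp hθ, fun k hspr n A B c hreal => ?_⟩
  have hpair := (isStrictlyPassive_of_isSPR hJ hφ hspr hreal).exists_isLyapunovPair
  refine ⟨hpair, fun N θ0 Γ hΓ S hS => ?_⟩
  obtain ⟨P, Q, hPQ⟩ := hpair
  refine ⟨fun P Q hPQ t ht => ⟨hS.lyapunov_hasDeriv hΓ hPQ t ht,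
      neg_nonpos.2 (Signals.IsAdaptiveLoop.quadratic_nonneg hPQ.posDef_Q (S.ex t))⟩,
    boundedSignal_iff.2 (hS.ex_bounded hΓ hPQ), boundedSignal_iff.2 (hS.ey_bounded hΓ hPQ),
    fun l i => boundedSignal_iff.2 (hS.parameter_bounded hΓ hPQ l i),
    hS.squareIntegrable hΓ hPQ, fun ⟨M, hM⟩ => ?_⟩
  have hdx : BddOnTime S.dx0 := ⟨M, fun t ht => (hM t ht).1⟩
  have hddx : BddOnTime S.ddx0 := ⟨M, fun t ht => (hM t ht).2⟩
  have hex := hS.ex_tendsto hp hΓ hPQ hdx hddx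
  have hey := hS.ey_tendsto hex
  refine ⟨fun l => boundedSignal_iff.2 (hS.regressor_bounded hp hΓ hPQ hdx hddx l), hex, hey,
    Signals.IsAdaptiveLoop.follower_tendsto hey, fun hx0 => ?_⟩
  have hy := hS.output_bounded hΓ hPQ hdx hx0
  have hx := fun i => hS.position_bounded hθ (hy i)
  exact ⟨boundedSignal_iff.2 hy, boundedSignal_iff.2 hx,
    boundedSignal_iff.2 fun i => Signals.IsAdaptiveLoop.velocity_bounded (hy i) (hx i)⟩
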